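/- **Setting.** Let $n\ge 0$, $\gamma\in\mathbb C$, let $V=\mathbb C^n$ with basis $(e_a)$ and let $\mathfrak h$ be the Lie algebra of diagonal matrices, with basis $h_i=E_{ii}$ and coordinates $\lambda=(\lambda_1,\dots,\lambda_n)$ on $\mathfrak h^*$. Let $\Lambda\subseteq\mathbb C^n$ be stable under translation by $\gamma\mathbb Z^n$; all functions of $\lambda$ below are defined on $\Lambda$. Put $\mathcal D=\sum_i h_i\partial_{\lambda_i}$, so that $e^{\gamma\mathcal D}f(\lambda)e^{-\gamma\mathcal D}=f(\lambda+\gamma h)$; $(h_k)$ means that $\lambda$ is replaced by $\lambda+\gamma h_k$, where $h_k$ acts on the $k$-th tensor factor. For a matrix $X(\lambda)$ on a tensor power of $V$ set $(X^{\pm SL})_{ij}=e^{\pm\gamma\partial_i}X_{ij}e^{\mp\gamma\partial_i}$ and $(X^{\pm SC})_{ij}=e^{\mp\gamma\partial_j}X_{ij}e^{\pm\gamma\partial_j}$, where for a multi-index $i=(i_1,\dots,i_k)$, $\partial_i=\sum_r\partial_{\lambda_{i_r}}$; an index on $SL$, $SC$ or on the transposition $t$ says on which tensor factors it is performed. Superscripts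 are applied from left to right. **Structure matrices.** For $R\in\{A,B,C,D\}$ let $R_{12}(u_1,u_2;\lambda)\in \mathrm{End}(V\otimes V)$, where $u_1,u_2$ are spectral parameters in a set $U$. Assume * zero weight: $[h\otimes 1+1\otimes h,R_{12}]=0$ for all $h\in\mathfrak h$ and $R=A,B,C,D$; * unitarity: $R_{12}(u_1,u_2;\lambda)R_{21}(u_2,u_1;\lambda)=1$ for $R=A,D$; * the Gervais–Neveu–Felder equations $$A_{12}A_{13}(h_2)A_{23}=A_{23}(h_1)A_{13}A_{12}(h_3),\qquad A_{12}C_{13}(h_2)C_{23}=C_{23}(h_1)C_{13}A_{12}(h_3),$$ $$D_{12}(h_3)D_{13}D_{23}(h_1)=D_{23}D_{13}(h_2)D_{12},\qquad D_{12}(h_3)B_{13}B_{23}(h_1)=B_{23}B_{13}(h_2)D_{12};$$ * $(B_{12}^{-SL_{12}})^{-SC_2t_2}$ and $(C_{12}^{-SL_{12}})^{-SC_1t_1}$ are invertible for all $u_1,u_2,\lambda$. The dual structure matrices are $$A^d_{12}=((A_{12}^{-SL_{12}})^{-1})^{-SC_{12}t_{12}},\quad B^d_{12}=(((B_{12}^{-SL_{12}})^{-SC_2t_2})^{-1})^{SL_1t_1},$$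 $$C^d_{12}=(((C_{12}^{-SL_{12}})^{-SC_1t_1})^{-1})^{SL_2t_2},\quad D^d_{12}=((D_{12}^{-SL_{12}})^{-1})^{SL_{12}t_{12}}.$$ **Fusion.** Let $M=\langle 1,\dots,m\rangle$ and $N'=\langle 1',\dots,m''\rangle$ (where $m''$ is the number of elements of $N'$) be ordered sets of labels of copies of $V$, each label carrying a spectral parameter. The fused structure matrices on $V^{\otimes M}\otimes V^{\otimes N'}$ are $$A_{M\bar N'}=\prod^{\to}_{i\in M}\prod^{\leftarrow}_{j\in N'}A_{ij}\Big(\sum_{k>i}h_k+\sum_{l>j}h_l\Big),\qquad B_{MN'}=\prod^{\to}_{i\in M}\prod^{\to}_{j\in N'}B_{ij}\Big(\sum_{k<i}h_k+\sum_{l>j}h_l\Big),$$ $$C_{MN'}=\prod^{\to}_{i\in M}\prod^{\to}_{j\in N'}C_{ij}\Big(\sum_{k>i}h_k+\sum_{l<j}h_l\Big),\qquad D_{M\bar N'}=\prod^{\to}_{i\in M}\prod^{\leftarrow}_{j\in N'}D_{ij}\Big(\sum_{k<i}h_k+\sum_{l<j}h_l\Big)$$ ($k\in M$, $l\in N'$),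 and $A^d_{M\bar N'},B^d_{MN'},C^d_{MN'},D^d_{M\bar N'}$ are built in the same way from $A^d,B^d,C^d,D^d$. Put $h_M=\sum_{k\in M}h_k$ and $\mathcal D_M=\sum_{k\in M}\mathcal D_k$. **Theorem.** Let $V_q,V_{q'}$ be complex vector spaces. Let $T_M(\lambda)$, $T_{N'}(\lambda)$ be matrices on $V^{\otimes M}$, $V^{\otimes N'}$ with entries in $\mathrm{End}(V_q)$ that satisfy the fused exchange relation $$A_{M\bar N'}\,T_M(h_{N'})\,B_{MN'}\,T_{N'}(h_M)=T_{N'}(h_M)\,C_{MN'}\,T_M(h_{N'})\,D_{M\bar N'},$$ and let $K_M(\lambda)$, $K_{N'}(\lambda)$ be matrices on $V^{\otimes M}$, $V^{\otimes N'}$ with entries in $\mathrm{End}(V_{q'})$ that satisfy the dual fused exchange relation $$A^d_{M\bar N'}\,K_M(h_{N'})\,B^d_{MN'}\,K_{N'}(h_M)=K_{N'}(h_M)\,C^d_{MN'}\,K_M(h_{N'})\,D^d_{M\bar N'}.$$ Then the operators $$H_M=\mathrm{Tr}_M\Big(e^{-\gamma\mathcal D_M}\,T_M\,e^{\gamma\mathcal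 D_M}\,(K_M^{SC})^{t_M}\Big)$$ and $H_{N'}$ (defined in the same way), acting on functions $\Lambda\to V_q\otimes V_{q'}$, commute: $[H_M,H_{N'}]=0$. In particular, if families $(T_M)$, $(K_M)$ satisfy these relations for all pairs of label sets, then the $H_M$ form a family of commuting operators. -/

import Mathlib

open scoped TensorProduct Kronecker Matrix

noncomputable section

namespace FullyDynamical

/-- Domain of the dynamical parameter `x ∈ 𝔥* ≅ ℂⁿ`: any subset of `ℂⁿ` stable under the translations
by `γ ℤⁿ` (all of `ℂⁿ`, or the complement of a translation-stable set of poles). -/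
structure DynDomain (n : ℕ) (γ : ℂ) where
  carrier : Set (Fin n → ℂ)
  shift_mem : ∀ x ∈ carrier, ∀ k : Fin n → ℤ, (fun i => x i + γ * (k i : ℂ)) ∈ carrier

/-- The points of the domain. -/
abbrev DynDomain.Pt {n : ℕ} {γ : ℂ} (Λ : DynDomain n γ) : Type := Λ.carrier

section

variable {n : ℕ} {γ : ℂ} {Λ : DynDomain n γ} {U : Type*}

/-- `x ↦ x + γ k`. -/
def shift (k : Fin n → ℤ) (x : Λ.Pt) : Λ.Pt :=
  ⟨fun i => x.1 i + γ * (k i : ℂ), Λ.shift_mem x.1 x.2 k⟩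

/-- Weight of the basis vector `e_a` of `V = ℂⁿ` under `h_i = E_{ii}`. -/
def wt (a : Fin n) : Fin n → ℤ := Pi.single a 1

/-- Total weight of the basis vector `⊗ e_{x r}` on the tensor factors `r ∈ S`. -/
def wtOn {L : Type*} (S : Finset L) (x : L → Fin n) : Fin n → ℤ := ∑ r ∈ S, wt (x r)

/-- Total weight `h_M` of the basis vector `⊗ e_{x r}`. -/
def wtAll {L : Type*} [Fintype L] (x : L → Fin n) : Fin n → ℤ := wtOn Finset.univ x

/-! ### Structure matrices -/

variable (Λ U) in
/-- A structure matrix `R₁₂(u₁, u₂; x) ∈ End(V ⊗ V)`. -/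
abbrev StructMat : Type _ := U → U → Λ.Pt → Matrix (Fin n × Fin n) (Fin n × Fin n) ℂ

/-- `[h ⊗ 1 + 1 ⊗ h, R₁₂] = 0` for all `h ∈ 𝔥`, the diagonal matrices. -/
def ZeroWeight (R : StructMat Λ U) : Prop :=
  ∀ (u v : U) (x : Λ.Pt) (h : Fin n → ℂ),
    Commute (Matrix.diagonal h ⊗ₖ (1 : Matrix (Fin n) (Fin n) ℂ)
      + (1 : Matrix (Fin n) (Fin n) ℂ) ⊗ₖ Matrix.diagonal h) (R u v x)

/-- `R₁₂(u₁, u₂; x) R₂₁(u₂, u₁; x) = 1`. -/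
def Unitary (R : StructMat Λ U) : Prop :=
  ∀ (u v : U) (x : Λ.Pt), R u v x * (R v u x).submatrix Prod.swap Prod.swap = 1

/-- For tensor factors labelled by `L`, with spectral parameters `u`, the operator
`R_{pq}(x + γ ∑_{r ∈ S} h_r)` on `V^{⊗ L}`, where `p ≠ q` and `p, q ∉ S`. -/
def site {L : Type*} [Fintype L] [DecidableEq L] (R : StructMat Λ U) (u : L → U) (p q : L)
    (S : Finset L) (x : Λ.Pt) : Matrix (L → Fin n) (L → Fin n) ℂ :=
  Matrix.of fun a b =>
    if ∀ r, r ≠ p → r ≠ q → a r = b r then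
      R (u p) (u q) (shift (wtOn S a) x) (a p, a q) (b p, b q)
    else 0

/-- `A₁₂ C₁₃(h₂) C₂₃ = C₂₃(h₁) C₁₃ A₁₂(h₃)`. -/
def GNFLeft (A C : StructMat Λ U) : Prop :=
  ∀ (u : Fin 3 → U) (x : Λ.Pt),
    site A u 0 1 ∅ x * site C u 0 2 {1} x * site C u 1 2 ∅ x =
      site C u 1 2 {0} x * site C u 0 2 ∅ x * site A u 0 1 {2} x

/-- `D₁₂(h₃) B₁₃ B₂₃(h₁) = B₂₃ B₁₃(h₂) D₁₂`. -/
def GNFRight (D B : StructMat Λ U) : Prop :=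
  ∀ (u : Fin 3 → U) (x : Λ.Pt),
    site D u 0 1 {2} x * site B u 0 2 ∅ x * site B u 1 2 {0} x =
      site B u 1 2 ∅ x * site B u 0 2 {1} x * site D u 0 1 ∅ x

/-! ### Shifts on line and column indices, partial transpositions, dual structure matrices -/

/-- `X^{SL}` with multiplicities: `lineShift 1 1` is `SL₁₂`, `lineShift (-1) (-1)` is `-SL₁₂`,
`lineShift 1 0` is `SL₁`, `lineShift 0 1` is `SL₂`; entry `(i, j)` of `X^{SL}` is
`e^{γ ∂_i} X_{ij} e^{-γ ∂_i}`. -/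
def lineShift (s t : ℤ) (X : Λ.Pt → Matrix (Fin n × Fin n) (Fin n × Fin n) ℂ) :
    Λ.Pt → Matrix (Fin n × Fin n) (Fin n × Fin n) ℂ :=
  fun x => Matrix.of fun i j => X (shift (s • wt i.1 + t • wt i.2) x) i j

/-- `X^{SC}` with multiplicities: `colShift 1 1` is `SC₁₂`, `colShift (-1) (-1)` is `-SC₁₂`,
`colShift (-1) 0` is `-SC₁`, `colShift 0 (-1)` is `-SC₂`; entry `(i, j)` of `X^{SC}` is
`e^{-γ ∂_j} X_{ij} e^{γ ∂_j}`. -/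
def colShift (s t : ℤ) (X : Λ.Pt → Matrix (Fin n × Fin n) (Fin n × Fin n) ℂ) :
    Λ.Pt → Matrix (Fin n × Fin n) (Fin n × Fin n) ℂ :=
  fun x => Matrix.of fun i j => X (shift (-(s • wt j.1 + t • wt j.2)) x) i j

/-- `X^{t₁}`. -/
def transp₁ (X : Λ.Pt → Matrix (Fin n × Fin n) (Fin n × Fin n) ℂ) :
    Λ.Pt → Matrix (Fin n × Fin n) (Fin n × Fin n) ℂ :=
  fun x => Matrix.of fun i j => X x (j.1, i.2) (i.1, j.2)

/-- `X^{t₂}`. -/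
def transp₂ (X : Λ.Pt → Matrix (Fin n × Fin n) (Fin n × Fin n) ℂ) :
    Λ.Pt → Matrix (Fin n × Fin n) (Fin n × Fin n) ℂ :=
  fun x => Matrix.of fun i j => X x (i.1, j.2) (j.1, i.2)

/-- `X^{t₁₂}`. -/
def transp₁₂ (X : Λ.Pt → Matrix (Fin n × Fin n) (Fin n × Fin n) ℂ) :
    Λ.Pt → Matrix (Fin n × Fin n) (Fin n × Fin n) ℂ :=
  fun x => (X x)ᵀ

/-- Pointwise inverse. -/
def invMat (X : Λ.Pt → Matrix (Fin n × Fin n) (Fin n × Fin n) ℂ) :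
    Λ.Pt → Matrix (Fin n × Fin n) (Fin n × Fin n) ℂ :=
  fun x => (X x)⁻¹

/-- `Aᵈ = ((A^{-SL₁₂})⁻¹)^{-SC₁₂ t₁₂}`. -/
def dualA (A : StructMat Λ U) : StructMat Λ U := fun u v =>
  transp₁₂ (colShift (-1) (-1) (invMat (lineShift (-1) (-1) (A u v))))

/-- `(B^{-SL₁₂})^{-SC₂ t₂}`. -/
def crossB (B : StructMat Λ U) : StructMat Λ U := fun u v =>
  transp₂ (colShift 0 (-1) (lineShift (-1) (-1) (B u v)))

/-- `Bᵈ = (((B^{-SL₁₂})^{-SC₂ t₂})⁻¹)^{SL₁ t₁}`. -/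
def dualB (B : StructMat Λ U) : StructMat Λ U := fun u v =>
  transp₁ (lineShift 1 0 (invMat (crossB B u v)))

/-- `(C^{-SL₁₂})^{-SC₁ t₁}`. -/
def crossC (C : StructMat Λ U) : StructMat Λ U := fun u v =>
  transp₁ (colShift (-1) 0 (lineShift (-1) (-1) (C u v)))

/-- `Cᵈ = (((C^{-SL₁₂})^{-SC₁ t₁})⁻¹)^{SL₂ t₂}`. -/
def dualC (C : StructMat Λ U) : StructMat Λ U := fun u v =>
  transp₂ (lineShift 0 1 (invMat (crossC C u v)))

/-- `Dᵈ = ((D^{-SL₁₂})⁻¹)^{SL₁₂ t₁₂}`. -/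
def dualD (D : StructMat Λ U) : StructMat Λ U := fun u v =>
  transp₁₂ (lineShift 1 1 (invMat (lineShift (-1) (-1) (D u v))))

/-- The conditions on the structure matrices of the fully dynamical quadratic algebra, including the
existence of the inverses that occur in the dual structure matrices. -/
structure IsStructureMatrices (A B C D : StructMat Λ U) : Prop where
  zeroWeight_A : ZeroWeight A
  zeroWeight_B : ZeroWeight B
  zeroWeight_C : ZeroWeight C
  zeroWeight_D : ZeroWeight D
  unitary_A : Unitary A
  unitary_D : Unitary D
  gnf_A : GNFLeft A A
  gnf_AC : GNFLeft A C
  gnf_D : GNFRight D D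
  gnf_DB : GNFRight D B
  isUnit_crossB : ∀ (u v : U) (x : Λ.Pt), IsUnit (crossB B u v x)
  isUnit_crossC : ∀ (u v : U) (x : Λ.Pt), IsUnit (crossC C u v x)

/-! ### Fused structure matrices

The auxiliary labels `M = ⟨1, …, m⟩` and `N' = ⟨1', …, m'⟩` are given by their spectral parameters
`M : Fin m → U`, `N : Fin m' → U`; the tensor factors are labelled by `Fin m ⊕ Fin m'`. -/

section Fusion

variable {m m' : ℕ}

/-- `A_{M N̄'} = ∏→_i ∏←_j A_{ij}(∑_{k > i} h_k + ∑_{l' > j'} h_{l'})`. -/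
def fuseA (A : StructMat Λ U) (M : Fin m → U) (N : Fin m' → U) (x : Λ.Pt) :
    Matrix (Fin m ⊕ Fin m' → Fin n) (Fin m ⊕ Fin m' → Fin n) ℂ :=
  ((List.finRange m).map fun i => ((List.finRange m').reverse.map fun j =>
    site A (Sum.elim M N) (.inl i) (.inr j)
      ((Finset.Ioi i).disjSum (Finset.Ioi j)) x).prod).prod

/-- `B_{M N'} = ∏→_i ∏→_j B_{ij}(∑_{k < i} h_k + ∑_{l' > j'} h_{l'})`. -/
def fuseB (B : StructMat Λ U) (M : Fin m → U) (N : Fin m' → U) (x : Λ.Pt) :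
    Matrix (Fin m ⊕ Fin m' → Fin n) (Fin m ⊕ Fin m' → Fin n) ℂ :=
  ((List.finRange m).map fun i => ((List.finRange m').map fun j =>
    site B (Sum.elim M N) (.inl i) (.inr j)
      ((Finset.Iio i).disjSum (Finset.Ioi j)) x).prod).prod

/-- `C_{M N'} = ∏→_i ∏→_j C_{ij}(∑_{k > i} h_k + ∑_{l' < j'} h_{l'})`. -/
def fuseC (C : StructMat Λ U) (M : Fin m → U) (N : Fin m' → U) (x : Λ.Pt) :
    Matrix (Fin m ⊕ Fin m' → Fin n) (Fin m ⊕ Fin m' → Fin n) ℂ :=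
  ((List.finRange m).map fun i => ((List.finRange m').map fun j =>
    site C (Sum.elim M N) (.inl i) (.inr j)
      ((Finset.Ioi i).disjSum (Finset.Iio j)) x).prod).prod

/-- `D_{M N̄'} = ∏→_i ∏←_j D_{ij}(∑_{k < i} h_k + ∑_{l' < j'} h_{l'})`. -/
def fuseD (D : StructMat Λ U) (M : Fin m → U) (N : Fin m' → U) (x : Λ.Pt) :
    Matrix (Fin m ⊕ Fin m' → Fin n) (Fin m ⊕ Fin m' → Fin n) ℂ :=
  ((List.finRange m).map fun i => ((List.finRange m').reverse.map fun j =>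
    site D (Sum.elim M N) (.inl i) (.inr j)
      ((Finset.Iio i).disjSum (Finset.Iio j)) x).prod).prod

variable {W : Type*} [AddCommGroup W] [Module ℂ W]

variable (Λ m W) in
/-- A matrix on `V^{⊗ m}` with entries operators on the quantum space `W`, depending on `x`. -/
abbrev AuxMat : Type _ :=
  Λ.Pt → Matrix (Fin m → Fin n) (Fin m → Fin n) (Module.End ℂ W)

/-- A scalar matrix acts as the identity on the quantum space. -/
def scal {P : Type*} (W : Type*) [AddCommGroup W] [Module ℂ W] (X : Matrix P P ℂ) :
    Matrix P P (Module.End ℂ W) :=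
  X.map (algebraMap ℂ (Module.End ℂ W))

/-- `T_M(x + γ h_{N'})` on `V^{⊗ M} ⊗ V^{⊗ N'}`. -/
def onLeft (T : AuxMat Λ m W) (x : Λ.Pt) :
    Matrix (Fin m ⊕ Fin m' → Fin n) (Fin m ⊕ Fin m' → Fin n) (Module.End ℂ W) :=
  Matrix.of fun a b =>
    if a ∘ Sum.inr = b ∘ Sum.inr then
      T (shift (wtAll (a ∘ Sum.inr)) x) (a ∘ Sum.inl) (b ∘ Sum.inl)
    else 0

/-- `T_{N'}(x + γ h_M)` on `V^{⊗ M} ⊗ V^{⊗ N'}`. -/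
def onRight (T : AuxMat Λ m' W) (x : Λ.Pt) :
    Matrix (Fin m ⊕ Fin m' → Fin n) (Fin m ⊕ Fin m' → Fin n) (Module.End ℂ W) :=
  Matrix.of fun a b =>
    if a ∘ Sum.inl = b ∘ Sum.inl then
      T (shift (wtAll (a ∘ Sum.inl)) x) (a ∘ Sum.inr) (b ∘ Sum.inr)
    else 0

/-- The fused exchange relation
`A_{MN̄'} T_M(h_{N'}) B_{MN'} T_{N'}(h_M) = T_{N'}(h_M) C_{MN'} T_M(h_{N'}) D_{MN̄'}`. -/
def FusedExchange (A B C D : StructMat Λ U) (M : Fin m → U) (N : Fin m' → U)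
    (TM : AuxMat Λ m W) (TN : AuxMat Λ m' W) : Prop :=
  ∀ x : Λ.Pt,
    scal W (fuseA A M N x) * onLeft TM x * scal W (fuseB B M N x) * onRight TN x =
      onRight TN x * scal W (fuseC C M N x) * onLeft TM x * scal W (fuseD D M N x)

/-- The dual fused exchange relation: the fused exchange relation of `Aᵈ, Bᵈ, Cᵈ, Dᵈ`. -/
def DualFusedExchange (A B C D : StructMat Λ U) (M : Fin m → U) (N : Fin m' → U)
    (KM : AuxMat Λ m W) (KN : AuxMat Λ m' W) : Prop :=
  FusedExchange (dualA A) (dualB B) (dualC C) (dualD D) M N KM KN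

end Fusion

/-! ### Difference operators and quantum traces -/

section Trace

variable {m : ℕ} {W W' : Type*} [AddCommGroup W] [Module ℂ W] [AddCommGroup W'] [Module ℂ W']

/-- `e^{γ ∂_k}` on `W`-valued functions, `f ↦ f(· + γ k)`. -/
def shiftOp (k : Fin n → ℤ) : Module.End ℂ (Λ.Pt → W) :=
  LinearMap.funLeft ℂ W (shift k)

/-- Multiplication by an operator-valued function. -/
def mulOp (F : Λ.Pt → Module.End ℂ W) : Module.End ℂ (Λ.Pt → W) :=
  LinearMap.pi fun x => F x ∘ₗ LinearMap.proj x

variable (Λ m W) in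
/-- `e^{s γ 𝒟_M}`, with `𝒟_M = ∑_{r ∈ M} ∑_i (h_i)_r ∂_i`: diagonal on the auxiliary space. -/
def expD (s : ℤ) : Matrix (Fin m → Fin n) (Fin m → Fin n) (Module.End ℂ (Λ.Pt → W)) :=
  Matrix.diagonal fun a => shiftOp (s • wtAll a)

/-- `T_M` as a matrix of operators on functions. -/
def opMat (T : AuxMat Λ m W) :
    Matrix (Fin m → Fin n) (Fin m → Fin n) (Module.End ℂ (Λ.Pt → W)) :=
  Matrix.of fun a b => mulOp fun x => T x a b

/-- `T_M` acting on the first factor of `V_q ⊗ V_{q'}`. -/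
def onQ (T : AuxMat Λ m W) : AuxMat Λ m (W ⊗[ℂ] W') :=
  fun x => (T x).map (LinearMap.rTensor W')

/-- `K_M` acting on the second factor of `V_q ⊗ V_{q'}`. -/
def onQ' (K : AuxMat Λ m W') : AuxMat Λ m (W ⊗[ℂ] W') :=
  fun x => (K x).map (LinearMap.lTensor W)

/-- `K^{SC}`: entry `(i, j)` is `e^{-γ ∂_j} K_{ij} e^{γ ∂_j}`. -/
def colShiftAux (K : AuxMat Λ m W) : AuxMat Λ m W :=
  fun x => Matrix.of fun a b => K (shift (-wtAll b) x) a b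

/-- `H_M = Tr_M e^{-γ𝒟_M} T_M e^{γ𝒟_M} (K_M^{SC})^{t_M}`, an operator on functions of the dynamical
parameter with values in `V_q ⊗ V_{q'}`. -/
def hamiltonian (T : AuxMat Λ m W) (K : AuxMat Λ m W') :
    Module.End ℂ (Λ.Pt → W ⊗[ℂ] W') :=
  Matrix.trace (expD Λ m (W ⊗[ℂ] W') (-1) * opMat (onQ T) * expD Λ m (W ⊗[ℂ] W') 1 *
    (opMat (colShiftAux (onQ' K)))ᵀ)

end Trace

end

end FullyDynamical

end

noncomputable section

namespace FullyDynamical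

section

variable {n : ℕ} {γ : ℂ} {Λ : DynDomain n γ} {U : Type*}

/-! ### Shifts and weights -/

/-! This is Sklyanin's argument for commuting transfer matrices, carried out with dynamical shifts.
Moving `e^{γ𝒟}` past the column-shifted `K` puts `T` and `K` at the same point, so each Hamiltonian
becomes a symmetric expression in the two matrices, the `pairing`: `∑ e^{-γ∂_p} (T_{pq} ⊗ K_{pq})
e^{γ∂_q}` (`hamiltonian_apply`).

The product `H_M H_{N'}` is then a single pairing on `V^{⊗M} ⊗ V^{⊗N'}`, of `T_M B T_{N'}` with `K_M
Bᵈ K_{N'}`. The matrices `B` and `Bᵈ` may be inserted because they are inverse to each other after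
partial transposition and shifts (`CrossInv`, `pairing_pairing`). Multiplying the two arguments on
the left by `A` and `Aᵈ` changes nothing, since `Aᵗ Aᵈ = 1` and `A` preserves weight
(`pairing_scal_mul`). Now both exchange relations apply at once (`FusedExchange.pairing_eq`). On the
other side `D, Dᵈ` are removed by `pairing_mul_scal` and `C, Cᵈ` by the crossing relation, which
leaves `H_{N'} H_M`.

It remains to carry the inverse relations from the structure matrices to the fused ones. For `A` and
`D` the ordered products telescope (`transpose_listProd_mul`). For `B` and `C` the crossing relation
composes in either tensor factor (`CrossInv.comp_left`, `CrossInv.comp_right`), and induction on the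
label sets gives `crossInv_fuseB` and `crossInv_fuseC`. Zero weight is used throughout to make the
shifts in each sum independent of the summation variables. -/

theorem shift_shift (k l : Fin n → ℤ) (x : Λ.Pt) : shift k (shift l x) = shift (k + l) x := by
  apply Subtype.ext
  funext i
  simp only [shift, Pi.add_apply, Int.cast_add]
  ring

@[simp]
theorem shift_zero (x : Λ.Pt) : shift 0 x = x := by
  apply Subtype.ext
  funext i
  simp [shift]

@[simp]
theorem wtOn_empty {L : Type*} (x : L → Fin n) : wtOn ∅ x = 0 := by
  simp [wtOn]

theorem wtOn_congr {L : Type*} {S : Finset L} {a b : L → Fin n} (h : ∀ r ∈ S, a r = b r) :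
    wtOn S a = wtOn S b :=
  Finset.sum_congr rfl fun r hr => by rw [h r hr]

theorem wtAll_sumElim {I J : Type*} [Fintype I] [Fintype J] (a : I → Fin n) (c : J → Fin n) :
    wtAll (Sum.elim a c) = wtAll a + wtAll c := by
  simp [wtAll, wtOn, Fintype.sum_sum_type]

/-! ### Adjoining tensor factors -/

section Emb

variable {L L' : Type*} [Fintype L] [DecidableEq L] [Fintype L']

open Classical in
/-- The operator on `V^{⊗ L}` that acts by `Q(x + γ ∑_{r ∈ S} h_r)` on the factors in the image of
`ι` and trivially on the others. -/
def emb (ι : L' → L) (S : Finset L) (Q : Λ.Pt → Matrix (L' → Fin n) (L' → Fin n) ℂ) :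
    Λ.Pt → Matrix (L → Fin n) (L → Fin n) ℂ :=
  fun x => Matrix.of fun a b =>
    if ∀ r, r ∉ Set.range ι → a r = b r then Q (shift (wtOn S a) x) (a ∘ ι) (b ∘ ι) else 0

theorem emb_one {ι : L' → L} (S : Finset L) :
    emb (Λ := Λ) ι S 1 = 1 := by
  classical
  funext x
  ext a b
  simp only [emb, Matrix.of_apply, Pi.one_apply, Matrix.one_apply]
  by_cases hab : a = b
  · simp [hab]
  · rw [if_neg hab]
    split_ifs with h h'
    · refine absurd (funext fun r => ?_) hab
      by_cases hr : r ∈ Set.range ι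
      · obtain ⟨s, rfl⟩ := hr
        exact congrFun h' s
      · exact h r hr
    · rfl
    · rfl

/-- The factors in `S` are spectators: their indices do not change from the row to the intermediate
state, so both operators see the same shift. -/
theorem emb_mul [DecidableEq L'] {ι : L' → L} (hι : Function.Injective ι) {S : Finset L} (hS : ∀ s, ι s ∉ S)
    (Q Q' : Λ.Pt → Matrix (L' → Fin n) (L' → Fin n) ℂ) :
    emb ι S (Q * Q') = emb ι S Q * emb ι S Q' := by
  classical
  funext x
  ext a b
  simp only [emb, Matrix.of_apply, Pi.mul_apply, Matrix.mul_apply]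
  simp only [ite_mul, zero_mul, mul_ite, mul_zero]
  have hoff : ∀ y : L → Fin n, (∀ r, r ∉ Set.range ι → a r = y r) → wtOn S y = wtOn S a := by
    intro y hy
    refine wtOn_congr fun r hr => (hy r ?_).symm
    rintro ⟨s, rfl⟩
    exact hS s hr
  have hext : ∀ y : L' → Fin n, Function.extend ι y a ∘ ι = y := fun y =>
    funext fun s => hι.extend_apply y a s
  have hext' : ∀ (y : L' → Fin n) r, r ∉ Set.range ι → Function.extend ι y a r = a r :=
    fun y r hr => Function.extend_apply' y a r hr
  split_ifs with h
  · rw [← Finset.sum_filter]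
    -- Intermediate states that contribute agree with `a` off the image of `ι`, hence are determined
    -- by their restriction along `ι`.
    refine Finset.sum_bij' (fun y _ => Function.extend ι y a) (fun y _ => y ∘ ι) ?_ ?_ ?_ ?_ ?_
    · intro y _
      simp only [Finset.mem_filter, Finset.mem_univ, true_and]
      intro r hr
      exact (hext' y r hr).trans (h r hr)
    · intro y _
      exact Finset.mem_univ _
    · intro y _
      exact hext y
    · intro y hy
      simp only [Finset.mem_filter, Finset.mem_univ, true_and] at hy
      funext r
      by_cases hr : r ∈ Set.range ι
      · obtain ⟨s, rfl⟩ := hr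
        rw [hι.extend_apply]
        rfl
      · rw [hext' _ r hr, hy r hr, h r hr]
    · intro y _
      have h1 : ∀ r, r ∉ Set.range ι → a r = Function.extend ι y a r := fun r hr =>
        (hext' y r hr).symm
      rw [if_pos h1, hext, hoff _ h1]
  · symm
    refine Finset.sum_eq_zero fun y _ => ?_
    split_ifs with h1 h2
    · exact absurd (fun r hr => (h2 r hr).trans (h1 r hr)) h
    · rfl
    · rfl

/-- `emb` as a homomorphism. -/
def embHom [DecidableEq L'] (ι : L' → L) (hι : Function.Injective ι) (S : Finset L) (hS : ∀ s, ι s ∉ S) :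
    (Λ.Pt → Matrix (L' → Fin n) (L' → Fin n) ℂ) →* (Λ.Pt → Matrix (L → Fin n) (L → Fin n) ℂ) where
  toFun := emb ι S
  map_one' := emb_one S
  map_mul' := emb_mul hι hS

theorem emb_transpose {ι : L' → L} {S : Finset L} (hS : ∀ s, ι s ∉ S)
    (Q : Λ.Pt → Matrix (L' → Fin n) (L' → Fin n) ℂ) (x : Λ.Pt) :
    (emb ι S Q x)ᵀ = emb ι S (fun y => (Q y)ᵀ) x := by
  classical
  ext a b
  simp only [emb, Matrix.of_apply, Matrix.transpose_apply]
  by_cases h : ∀ r, r ∉ Set.range ι → a r = b r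
  · have hw : wtOn S b = wtOn S a := by
      refine wtOn_congr fun r hr => (h r ?_).symm
      rintro ⟨s, rfl⟩
      exact hS s hr
    rw [if_pos h, if_pos fun r hr => (h r hr).symm, hw]
  · rw [if_neg h, if_neg fun h' => h fun r hr => (h' r hr).symm]

/-- Shifts accumulate: `S` is disjoint from the image of `ι`, so the weights on `S` and on the image
of `S'` add without double counting. -/
theorem emb_site [DecidableEq L'] {ι : L' → L} (hι : Function.Injective ι) {S : Finset L} (hS : ∀ s, ι s ∉ S)
    (R : StructMat Λ U) (u : L → U) (p q : L') (S' : Finset L') :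
    emb ι S (site R (u ∘ ι) p q S') = site R u (ι p) (ι q) (S ∪ S'.image ι) := by
  classical
  funext x
  ext a b
  simp only [emb, site, Matrix.of_apply]
  have hiff : ((∀ r, r ∉ Set.range ι → a r = b r) ∧
      ∀ r, r ≠ p → r ≠ q → (a ∘ ι) r = (b ∘ ι) r) ↔ ∀ r, r ≠ ι p → r ≠ ι q → a r = b r := by
    constructor
    · rintro ⟨h1, h2⟩ r hp hq
      by_cases hr : r ∈ Set.range ι
      · obtain ⟨s, rfl⟩ := hr
        exact h2 s (fun h => hp (h ▸ rfl)) (fun h => hq (h ▸ rfl))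
      · exact h1 r hr
    · intro h
      exact ⟨fun r hr => h r (fun e => hr ⟨p, e.symm⟩) (fun e => hr ⟨q, e.symm⟩),
        fun r hp hq => h (ι r) (hι.ne hp) (hι.ne hq)⟩
  have hw : wtOn S' (a ∘ ι) + wtOn S a = wtOn (S ∪ S'.image ι) a := by
    unfold wtOn
    rw [Finset.sum_union, Finset.sum_image fun _ _ _ _ h => hι h, add_comm]
    · rfl
    · rw [Finset.disjoint_left]
      intro r hr h
      obtain ⟨s, -, rfl⟩ := Finset.mem_image.1 h
      exact hS s hr
  rw [← ite_and, shift_shift, hw]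
  exact if_congr hiff rfl rfl

/-- A structure matrix as an operator on the tensor factors labelled by `Fin 2`. -/
def pairMat (X : Matrix (Fin n × Fin n) (Fin n × Fin n) ℂ) :
    Matrix (Fin 2 → Fin n) (Fin 2 → Fin n) ℂ :=
  X.submatrix (fun a => (a 0, a 1)) fun a => (a 0, a 1)

theorem site_eq_emb (R : StructMat Λ U) (u : L → U) {p q : L} (S : Finset L) :
    site R u p q S = emb ![p, q] S fun x => pairMat (R (u p) (u q) x) := by
  classical
  funext x
  ext a b
  simp only [emb, site, Matrix.of_apply, pairMat, Matrix.submatrix_apply]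
  have hiff : (∀ r, r ∉ Set.range ![p, q] → a r = b r) ↔ ∀ r, r ≠ p → r ≠ q → a r = b r := by
    simp only [Matrix.range_cons, Matrix.range_empty, Set.union_empty, Set.mem_union,
      Set.mem_singleton_iff, not_or, and_imp]
  simp only [hiff]
  rfl

end Emb

/-! ### Conservation of weight -/

theorem ZeroWeight.wt_eq {R : StructMat Λ U} (hR : ZeroWeight R) {u v : U} {x : Λ.Pt}
    {i j : Fin n × Fin n} (h : R u v x i j ≠ 0) : wt i.1 + wt i.2 = wt j.1 + wt j.2 := by
  funext k
  -- Commutation with `h = E_{kk}` compares the `k`-th components of the two weights, each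
  -- multiplied by the nonzero entry.
  have h1 := congrFun (congrFun (hR u v x (Pi.single k 1)).eq i) j
  have hd : Matrix.diagonal (Pi.single k 1 : Fin n → ℂ) ⊗ₖ (1 : Matrix (Fin n) (Fin n) ℂ)
      + (1 : Matrix (Fin n) (Fin n) ℂ) ⊗ₖ Matrix.diagonal (Pi.single k 1) =
      Matrix.diagonal fun i => (Pi.single k 1 : Fin n → ℂ) i.1 + (Pi.single k 1 : Fin n → ℂ) i.2 := by
    rw [← Matrix.diagonal_one, Matrix.diagonal_kronecker_diagonal,
      Matrix.diagonal_kronecker_diagonal, Matrix.diagonal_add]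
    simp
  rw [hd, Matrix.diagonal_mul, Matrix.mul_diagonal, mul_comm] at h1
  have h2 := mul_left_cancel₀ h h1
  simp only [wt, Pi.add_apply, Pi.single_apply] at h2 ⊢
  have h3 : ∀ a : Fin n, (if k = a then (1 : ℤ) else 0) = if a = k then 1 else 0 := fun a => by
    simp [eq_comm]
  rw [h3, h3, h3, h3]
  exact_mod_cast h2

/-- A matrix on `V^{⊗ L}` which commutes with `𝔥`. -/
def PreservesWt {L : Type*} [Fintype L] (X : Matrix (L → Fin n) (L → Fin n) ℂ) : Prop :=
  ∀ a b, X a b ≠ 0 → wtAll a = wtAll b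

section

variable {L : Type*} [Fintype L]

theorem PreservesWt.one [DecidableEq L] : PreservesWt (1 : Matrix (L → Fin n) (L → Fin n) ℂ) := by
  intro a b h
  by_contra hab
  exact h (Matrix.one_apply_ne fun e => hab (by rw [e]))

theorem PreservesWt.mul [DecidableEq L] {X Y : Matrix (L → Fin n) (L → Fin n) ℂ} (hX : PreservesWt X)
    (hY : PreservesWt Y) : PreservesWt (X * Y) := by
  intro a b h
  rw [Matrix.mul_apply] at h
  obtain ⟨y, -, hy⟩ := Finset.exists_ne_zero_of_sum_ne_zero h
  exact (hX a y (left_ne_zero_of_mul hy)).trans (hY y b (right_ne_zero_of_mul hy))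

theorem PreservesWt.listProd [DecidableEq L] {I : Type*} (l : List I) {f : I → Matrix (L → Fin n) (L → Fin n) ℂ}
    (hf : ∀ i, PreservesWt (f i)) : PreservesWt (l.map f).prod := by
  induction l with
  | nil => exact PreservesWt.one
  | cons i l ih => simpa using (hf i).mul ih

theorem ZeroWeight.preservesWt_site [DecidableEq L] {R : StructMat Λ U} (hR : ZeroWeight R) (u : L → U) {p q : L}
    (hpq : p ≠ q) (S : Finset L) (x : Λ.Pt) : PreservesWt (site R u p q S x) := by
  intro a b h
  simp only [site, Matrix.of_apply] at h
  split_ifs at h with hab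
  · have hw := hR.wt_eq h
    have hs : ∀ y : L → Fin n, wtAll y = (wt (y p) + wt (y q)) +
        ∑ r ∈ (Finset.univ.erase p).erase q, wt (y r) := by
      intro y
      rw [wtAll, wtOn, ← Finset.add_sum_erase _ _ (Finset.mem_univ p),
        ← Finset.add_sum_erase _ _ (Finset.mem_erase.2 ⟨hpq.symm, Finset.mem_univ q⟩), add_assoc]
    rw [hs a, hs b]
    congr 1
    refine Finset.sum_congr rfl fun r hr => ?_
    simp only [Finset.mem_erase, Finset.mem_univ, and_true] at hr
    rw [hab r hr.2 hr.1]
  · exact absurd rfl h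

end

variable {m m' : ℕ}

theorem ZeroWeight.fuseA {R : StructMat Λ U} (hR : ZeroWeight R) (M : Fin m → U) (N : Fin m' → U)
    (x : Λ.Pt) : PreservesWt (fuseA R M N x) :=
  PreservesWt.listProd _ fun _ => PreservesWt.listProd _ fun _ =>
    hR.preservesWt_site _ Sum.inl_ne_inr _ _

theorem ZeroWeight.fuseB {R : StructMat Λ U} (hR : ZeroWeight R) (M : Fin m → U) (N : Fin m' → U)
    (x : Λ.Pt) : PreservesWt (fuseB R M N x) :=
  PreservesWt.listProd _ fun _ => PreservesWt.listProd _ fun _ =>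
    hR.preservesWt_site _ Sum.inl_ne_inr _ _

theorem ZeroWeight.fuseC {R : StructMat Λ U} (hR : ZeroWeight R) (M : Fin m → U) (N : Fin m' → U)
    (x : Λ.Pt) : PreservesWt (fuseC R M N x) :=
  PreservesWt.listProd _ fun _ => PreservesWt.listProd _ fun _ =>
    hR.preservesWt_site _ Sum.inl_ne_inr _ _

theorem ZeroWeight.fuseD {R : StructMat Λ U} (hR : ZeroWeight R) (M : Fin m → U) (N : Fin m' → U)
    (x : Λ.Pt) : PreservesWt (fuseD R M N x) :=
  PreservesWt.listProd _ fun _ => PreservesWt.listProd _ fun _ =>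
    hR.preservesWt_site _ Sum.inl_ne_inr _ _

/-! ### `A` and `D` and their duals -/

theorem shift_eq_of_wt_eq {i j : Fin n × Fin n} (h : wt i.1 + wt i.2 = wt j.1 + wt j.2)
    (x : Λ.Pt) : shift ((-1 : ℤ) • wt i.1 + (-1 : ℤ) • wt i.2) (shift (wt j.1 + wt j.2) x) = x := by
  rw [shift_shift, ← h]
  convert shift_zero x using 2
  simp only [neg_smul, one_smul]
  abel

/-- A line shift by the total weight is multiplicative when the left factor has zero weight, because
row and intermediate index then carry the same shift. So the shifted `R₂₁` inverts the shifted
`R₁₂`. -/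
theorem Unitary.isUnit_lineShift {R : StructMat Λ U} (hR : Unitary R) (hw : ZeroWeight R) (u v : U)
    (x : Λ.Pt) : IsUnit (lineShift (-1) (-1) (R u v) x) := by
  rw [Matrix.isUnit_iff_isUnit_det]
  refine Matrix.isUnit_det_of_right_inverse (B := lineShift (-1) (-1)
    (fun y => (R v u y).submatrix Prod.swap Prod.swap) x) ?_
  ext i k
  have h := congrFun (congrFun (hR u v (shift ((-1 : ℤ) • wt i.1 + (-1 : ℤ) • wt i.2) x)) i) k
  have h1 : (1 : Matrix (Fin n × Fin n) (Fin n × Fin n) ℂ) i k = _ := h.symm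
  rw [h1, Matrix.mul_apply, Matrix.mul_apply]
  refine Finset.sum_congr rfl fun j _ => ?_
  simp only [lineShift, Matrix.of_apply]
  by_cases hz : R u v (shift ((-1 : ℤ) • wt i.1 + (-1 : ℤ) • wt i.2) x) i j = 0
  · rw [hz, zero_mul, zero_mul]
  · rw [← smul_add, ← smul_add, hw.wt_eq hz]

theorem Unitary.transpose_mul_dualA {R : StructMat Λ U} (hR : Unitary R) (hw : ZeroWeight R)
    (u v : U) (x : Λ.Pt) : (R u v x)ᵀ * dualA R u v x = 1 := by
  ext j k
  -- The base point is moved by the weight of `j` so that the line shift by minus the weight of `i`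
  -- cancels it whenever `R_{ij} ≠ 0`.
  have hu := hR.isUnit_lineShift hw u v (shift (wt j.1 + wt j.2) x)
  have h := congrFun (congrFun (Matrix.nonsing_inv_mul _ ((Matrix.isUnit_iff_isUnit_det _).1 hu)) k) j
  have h1 : (1 : Matrix (Fin n × Fin n) (Fin n × Fin n) ℂ) j k = _ :=
    (show _ = (1 : Matrix (Fin n × Fin n) (Fin n × Fin n) ℂ) k j by
      simp only [Matrix.one_apply, eq_comm]).trans h.symm
  rw [h1, Matrix.mul_apply, Matrix.mul_apply]
  refine Finset.sum_congr rfl fun i _ => ?_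
  simp only [dualA, transp₁₂, colShift, invMat, Matrix.transpose_apply, Matrix.of_apply]
  rw [mul_comm]
  by_cases hz : R u v x i j = 0
  · rw [hz, mul_zero]
    by_cases hij : wt i.1 + wt i.2 = wt j.1 + wt j.2
    · simp only [lineShift, Matrix.of_apply, shift_eq_of_wt_eq hij, hz, mul_zero]
    · have : lineShift (-1) (-1) (R u v) (shift (wt j.1 + wt j.2) x) i j = 0 := by
        by_contra hne
        exact hij (hw.wt_eq hne)
      rw [this, mul_zero]
  · have hij := hw.wt_eq hz
    have h2 : lineShift (-1) (-1) (R u v) (shift (wt j.1 + wt j.2) x) i j = R u v x i j := by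
      simp only [lineShift, Matrix.of_apply, shift_eq_of_wt_eq hij]
    have h3 : -((-1 : ℤ) • wt i.1 + (-1 : ℤ) • wt i.2) = wt j.1 + wt j.2 := by
      rw [← hij]
      simp only [neg_smul, one_smul]
      abel
    rw [h2, h3]

theorem Unitary.transpose_mul_dualD {R : StructMat Λ U} (hR : Unitary R) (hw : ZeroWeight R)
    (u v : U) (x : Λ.Pt) : (R u v x)ᵀ * dualD R u v x = 1 := by
  -- The definition of `dualD` yields the inverse on the right most directly; the stated form
  -- follows since one-sided inverses of square matrices are two-sided.
  have key : R u v x * (dualD R u v x)ᵀ = 1 := by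
    ext p r
    have hu := hR.isUnit_lineShift hw u v (shift (wt p.1 + wt p.2) x)
    have h := congrFun (congrFun (Matrix.mul_nonsing_inv _
      ((Matrix.isUnit_iff_isUnit_det _).1 hu)) p) r
    rw [← h, Matrix.mul_apply, Matrix.mul_apply]
    refine Finset.sum_congr rfl fun q _ => ?_
    have h2 : lineShift (-1) (-1) (R u v) (shift (wt p.1 + wt p.2) x) p q = R u v x p q := by
      simp only [lineShift, Matrix.of_apply, shift_eq_of_wt_eq rfl]
    rw [h2]
    by_cases hz : R u v x p q = 0
    · rw [hz, zero_mul, zero_mul]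
    · simp only [dualD, transp₁₂, Matrix.transpose_apply]
      conv_lhs => rw [lineShift]
      simp only [Matrix.of_apply, one_smul, hw.wt_eq hz, invMat]
  rw [mul_eq_one_comm]
  have := congrArg Matrix.transpose (mul_eq_one_comm.1 key)
  rw [mul_eq_one_comm]
  simpa using this

theorem transpose_pairMat_mul {X Y : Matrix (Fin n × Fin n) (Fin n × Fin n) ℂ} (h : Xᵀ * Y = 1) :
    (pairMat X)ᵀ * pairMat Y = 1 := by
  rw [pairMat, pairMat, Matrix.transpose_submatrix]
  have := Matrix.submatrix_mul_equiv Xᵀ Y (fun a : Fin 2 → Fin n => (a 0, a 1))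
    (finTwoArrowEquiv (Fin n)) fun a : Fin 2 → Fin n => (a 0, a 1)
  refine this.trans ?_
  rw [h]
  exact Matrix.submatrix_one _ (finTwoArrowEquiv (Fin n)).injective

theorem transpose_site_mul {L : Type*} [Fintype L] [DecidableEq L] {R R' : StructMat Λ U}
    (h : ∀ u v x, (R u v x)ᵀ * R' u v x = 1) (u : L → U) {p q : L} (hpq : p ≠ q) {S : Finset L}
    (hp : p ∉ S) (hq : q ∉ S) (x : Λ.Pt) : (site R u p q S x)ᵀ * site R' u p q S x = 1 := by
  have hS : ∀ s, (![p, q] : Fin 2 → L) s ∉ S := fun s => by fin_cases s <;> simpa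
  have hι : Function.Injective (![p, q] : Fin 2 → L) := by
    intro i j hij
    fin_cases i <;> fin_cases j <;> simp_all
  rw [site_eq_emb, site_eq_emb, emb_transpose hS, ← Pi.mul_apply, ← emb_mul hι hS]
  have : (fun y => (pairMat (R (u p) (u q) y))ᵀ) * (fun y => pairMat (R' (u p) (u q) y)) =
      (1 : Λ.Pt → Matrix (Fin 2 → Fin n) (Fin 2 → Fin n) ℂ) :=
    funext fun y => transpose_pairMat_mul (h _ _ y)
  rw [this, emb_one, Pi.one_apply]

/-- Transposition reverses the first product, so the two copies of each factor meet in the middle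
and cancel. This is why the dual matrices are fused in the same order as the original ones. -/
theorem transpose_listProd_mul {I P : Type*} [Fintype P] [DecidableEq P] (l : List I)
    {f g : I → Matrix P P ℂ} (h : ∀ i, (f i)ᵀ * g i = 1) :
    (l.map f).prodᵀ * (l.map g).prod = 1 := by
  induction l with
  | nil => simp
  | cons i l ih =>
    simp only [List.map_cons, List.prod_cons, Matrix.transpose_mul]
    rw [Matrix.mul_assoc, ← Matrix.mul_assoc _ (g i), h, Matrix.one_mul, ih]

theorem transpose_fuseA_mul {R R' : StructMat Λ U} (h : ∀ u v x, (R u v x)ᵀ * R' u v x = 1)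
    (M : Fin m → U) (N : Fin m' → U) (x : Λ.Pt) : (fuseA R M N x)ᵀ * fuseA R' M N x = 1 :=
  transpose_listProd_mul _ fun _ => transpose_listProd_mul _ fun _ =>
    transpose_site_mul h _ Sum.inl_ne_inr (by simp) (by simp) x

theorem transpose_fuseD_mul {R R' : StructMat Λ U} (h : ∀ u v x, (R u v x)ᵀ * R' u v x = 1)
    (M : Fin m → U) (N : Fin m' → U) (x : Λ.Pt) : (fuseD R M N x)ᵀ * fuseD R' M N x = 1 :=
  transpose_listProd_mul _ fun _ => transpose_listProd_mul _ fun _ =>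
    transpose_site_mul h _ Sum.inl_ne_inr (by simp) (by simp) x

end

section

variable {n : ℕ} {γ : ℂ} {Λ : DynDomain n γ} {U : Type*}

/-! ### Crossing relation between `B`, `C` and their duals -/

open Classical in
/-- The crossing relation between a matrix `X` on a tensor product of spaces with bases `α` and `β`
and its dual `Y`: they are inverse to each other after partial transpositions and shifts. -/
def CrossInv {α β : Type*} [Fintype α] [Fintype β] (w : α → Fin n → ℤ)
    (X Y : Λ.Pt → α → β → α → β → ℂ) : Prop :=
  ∀ (z : Λ.Pt) (b : α) (c' : β) (b₁ : α) (c₁ : β),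
    ∑ c, ∑ b', X (shift (-w b') z) b c b' c' * Y (shift (-w b') z) b₁ c b' c₁ =
      if b = b₁ ∧ c' = c₁ then 1 else 0

section

variable {α α₀ α₁ β β₀ β₁ : Type*} [Fintype α] [Fintype α₀] [Fintype α₁] [Fintype β] [Fintype β₀]
  [Fintype β₁]

/-- Composition of crossing relations in the first tensor factor. -/
theorem CrossInv.comp_left {w₀ : α₀ → Fin n → ℤ} {w₁ : α₁ → Fin n → ℤ} {w : α → Fin n → ℤ}
    {P P' : Λ.Pt → α₀ → β → α₀ → β → ℂ} {Q Q' : Λ.Pt → α₁ → β → α₁ → β → ℂ}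
    {X X' : Λ.Pt → α → β → α → β → ℂ} (hP : CrossInv w₀ P P') (hQ : CrossInv w₁ Q Q')
    (e : α ≃ α₀ × α₁) (hw : ∀ a, w a = w₀ (e a).1 + w₁ (e a).2)
    (hX : ∀ x b c b' c', X x b c b' c' =
      ∑ f, P x (e b).1 c (e b').1 f * Q (shift (w₀ (e b').1) x) (e b).2 f (e b').2 c')
    (hX' : ∀ x b c b' c', X' x b c b' c' =
      ∑ f, P' x (e b).1 c (e b').1 f * Q' (shift (w₀ (e b').1) x) (e b).2 f (e b').2 c') :
    CrossInv w X X' := by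
  classical
  intro z b c' b₁ c₁
  -- Undoing the shift of the first block leaves exactly the point at which `Q` is evaluated, so the
  -- sum over `P` can be done first with that point as base.
  have hs : ∀ b', shift (-w b') z = shift (-w₀ (e b').1) (shift (-w₁ (e b').2) z) := fun b' => by
    rw [shift_shift, hw, neg_add]
  have hs' : ∀ b', shift (w₀ (e b').1) (shift (-w b') z) = shift (-w₁ (e b').2) z := fun b' => by
    rw [shift_shift, hw, neg_add, add_neg_cancel_left]
  calc _ = ∑ c, ∑ b', ∑ f, ∑ g, (Q (shift (-w₁ (e b').2) z) (e b).2 f (e b').2 c' *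
            Q' (shift (-w₁ (e b').2) z) (e b₁).2 g (e b').2 c₁) *
          (P (shift (-w₀ (e b').1) (shift (-w₁ (e b').2) z)) (e b).1 c (e b').1 f *
            P' (shift (-w₀ (e b').1) (shift (-w₁ (e b').2) z)) (e b₁).1 c (e b').1 g) := by
        refine Finset.sum_congr rfl fun c _ => Finset.sum_congr rfl fun b' _ => ?_
        rw [hX, hX', Finset.sum_mul_sum]
        refine Finset.sum_congr rfl fun f _ => Finset.sum_congr rfl fun g _ => ?_
        rw [hs', hs]
        ring
    _ = ∑ c, ∑ v, ∑ s, ∑ f, ∑ g, (Q (shift (-w₁ s) z) (e b).2 f s c' *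
            Q' (shift (-w₁ s) z) (e b₁).2 g s c₁) *
          (P (shift (-w₀ v) (shift (-w₁ s) z)) (e b).1 c v f *
            P' (shift (-w₀ v) (shift (-w₁ s) z)) (e b₁).1 c v g) := by
        refine Finset.sum_congr rfl fun c _ => ?_
        rw [← Fintype.sum_prod_type' (f := fun v s => ∑ f, ∑ g,
          (Q (shift (-w₁ s) z) (e b).2 f s c' * Q' (shift (-w₁ s) z) (e b₁).2 g s c₁) *
          (P (shift (-w₀ v) (shift (-w₁ s) z)) (e b).1 c v f *
            P' (shift (-w₀ v) (shift (-w₁ s) z)) (e b₁).1 c v g))]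
        exact Fintype.sum_equiv e _ _ fun _ => rfl
    _ = ∑ s, ∑ f, ∑ g, (Q (shift (-w₁ s) z) (e b).2 f s c' *
            Q' (shift (-w₁ s) z) (e b₁).2 g s c₁) *
          ∑ c, ∑ v, (P (shift (-w₀ v) (shift (-w₁ s) z)) (e b).1 c v f *
            P' (shift (-w₀ v) (shift (-w₁ s) z)) (e b₁).1 c v g) := by
        simp only [Finset.mul_sum]
        rw [Finset.sum_congr rfl fun c _ => Finset.sum_comm, Finset.sum_comm]
        refine Finset.sum_congr rfl fun s _ => ?_
        rw [Finset.sum_congr rfl fun c _ => Finset.sum_comm, Finset.sum_comm]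
        refine Finset.sum_congr rfl fun f _ => ?_
        rw [Finset.sum_congr rfl fun c _ => Finset.sum_comm, Finset.sum_comm]
    _ = ∑ s, ∑ f, ∑ g, (Q (shift (-w₁ s) z) (e b).2 f s c' *
            Q' (shift (-w₁ s) z) (e b₁).2 g s c₁) *
          (if f = g then if (e b).1 = (e b₁).1 then 1 else 0 else 0) := by
        refine Finset.sum_congr rfl fun s _ => Finset.sum_congr rfl fun f _ =>
          Finset.sum_congr rfl fun g _ => ?_
        rw [hP, ← ite_and]
        simp only [and_comm]
    _ = if (e b).1 = (e b₁).1 then ∑ f, ∑ s, Q (shift (-w₁ s) z) (e b).2 f s c' *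
            Q' (shift (-w₁ s) z) (e b₁).2 f s c₁ else 0 := by
        rw [Finset.sum_comm]
        simp only [mul_ite, mul_zero, Finset.sum_ite_eq, Finset.mem_univ, if_true, mul_one]
        split_ifs
        · rfl
        · simp
    _ = _ := by
        rw [hQ, ← ite_and]
        refine if_congr ?_ rfl rfl
        rw [← and_assoc, ← Prod.ext_iff, e.apply_eq_iff_eq]

/-- Composition of crossing relations in the second tensor factor. -/
theorem CrossInv.comp_right {w : α → Fin n → ℤ} {v₁ : β₁ → Fin n → ℤ}
    {P P' : Λ.Pt → α → β₀ → α → β₀ → ℂ} {Q Q' : Λ.Pt → α → β₁ → α → β₁ → ℂ}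
    {X X' : Λ.Pt → α → β → α → β → ℂ} (hP : CrossInv w P P') (hQ : CrossInv w Q Q')
    (hQw : ∀ x b c b' c', Q x b c b' c' ≠ 0 → w b + v₁ c = w b' + v₁ c')
    (e : β ≃ β₀ × β₁)
    (hX : ∀ x b c b' c', X x b c b' c' =
      ∑ f, P (shift (v₁ (e c).2) x) b (e c).1 f (e c').1 * Q x f (e c).2 b' (e c').2)
    (hX' : ∀ x b c b' c', X' x b c b' c' =
      ∑ f, P' (shift (v₁ (e c).2) x) b (e c).1 f (e c').1 * Q' x f (e c).2 b' (e c').2) :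
    CrossInv w X X' := by
  classical
  intro z b c' b₁ c₁
  calc _ = ∑ c, ∑ b', ∑ f, ∑ g,
          (P (shift (-w f) (shift (v₁ (e c').2) z)) b (e c).1 f (e c').1 *
            P' (shift (-w f) (shift (v₁ (e c').2) z)) b₁ (e c).1 g (e c₁).1) *
          (Q (shift (-w b') z) f (e c).2 b' (e c').2 *
            Q' (shift (-w b') z) g (e c).2 b' (e c₁).2) := by
        refine Finset.sum_congr rfl fun c _ => Finset.sum_congr rfl fun b' _ => ?_
        rw [hX, hX', Finset.sum_mul_sum]
        refine Finset.sum_congr rfl fun f _ => Finset.sum_congr rfl fun g _ => ?_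
        by_cases hz : Q (shift (-w b') z) f (e c).2 b' (e c').2 = 0
        · rw [hz]
          ring
        -- Weight conservation of `Q` frees the argument of `P` from `b'` and from the second
        -- component of `c`, so the sum over `Q` can be done first.
        · have h : shift (v₁ (e c).2) (shift (-w b') z) =
              shift (-w f) (shift (v₁ (e c').2) z) := by
            rw [shift_shift, shift_shift]
            congr 1
            have := hQw _ _ _ _ _ hz
            rw [← sub_eq_add_neg, neg_add_eq_sub, sub_eq_sub_iff_add_eq_add, add_comm, this,
              add_comm]
          rw [h]
          ring
    _ = ∑ p, ∑ q, ∑ b', ∑ f, ∑ g,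
          (P (shift (-w f) (shift (v₁ (e c').2) z)) b p f (e c').1 *
            P' (shift (-w f) (shift (v₁ (e c').2) z)) b₁ p g (e c₁).1) *
          (Q (shift (-w b') z) f q b' (e c').2 * Q' (shift (-w b') z) g q b' (e c₁).2) := by
        rw [← Fintype.sum_prod_type' (f := fun p q => ∑ b', ∑ f, ∑ g,
          (P (shift (-w f) (shift (v₁ (e c').2) z)) b p f (e c').1 *
            P' (shift (-w f) (shift (v₁ (e c').2) z)) b₁ p g (e c₁).1) *
          (Q (shift (-w b') z) f q b' (e c').2 * Q' (shift (-w b') z) g q b' (e c₁).2))]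
        exact Fintype.sum_equiv e _ _ fun _ => rfl
    _ = ∑ p, ∑ f, ∑ g,
          (P (shift (-w f) (shift (v₁ (e c').2) z)) b p f (e c').1 *
            P' (shift (-w f) (shift (v₁ (e c').2) z)) b₁ p g (e c₁).1) *
          ∑ q, ∑ b', (Q (shift (-w b') z) f q b' (e c').2 *
            Q' (shift (-w b') z) g q b' (e c₁).2) := by
        refine Finset.sum_congr rfl fun p _ => ?_
        simp only [Finset.mul_sum]
        rw [Finset.sum_congr rfl fun q _ => Finset.sum_comm, Finset.sum_comm]
        refine Finset.sum_congr rfl fun f _ => ?_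
        rw [Finset.sum_congr rfl fun q _ => Finset.sum_comm, Finset.sum_comm]
    _ = ∑ p, ∑ f, ∑ g,
          (P (shift (-w f) (shift (v₁ (e c').2) z)) b p f (e c').1 *
            P' (shift (-w f) (shift (v₁ (e c').2) z)) b₁ p g (e c₁).1) *
          (if f = g then if (e c').2 = (e c₁).2 then 1 else 0 else 0) := by
        refine Finset.sum_congr rfl fun p _ => Finset.sum_congr rfl fun f _ =>
          Finset.sum_congr rfl fun g _ => ?_
        rw [hQ, ← ite_and]
    _ = if (e c').2 = (e c₁).2 then ∑ p, ∑ f,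
          (P (shift (-w f) (shift (v₁ (e c').2) z)) b p f (e c').1 *
            P' (shift (-w f) (shift (v₁ (e c').2) z)) b₁ p f (e c₁).1) else 0 := by
        simp only [mul_ite, mul_zero, Finset.sum_ite_eq, Finset.mem_univ, if_true, mul_one]
        split_ifs
        · rfl
        · simp
    _ = _ := by
        -- The relation for `P` is applied at the base point `z` shifted by the weight of the second
        -- component of `c'`, which is fixed.
        rw [hP, ← ite_and]
        refine if_congr ?_ rfl rfl
        rw [and_left_comm, and_comm (a := (e c').2 = _), ← Prod.ext_iff, e.apply_eq_iff_eq]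

end

/-! ### Decomposition of the fused matrices -/

variable {m m' : ℕ}

/-- Splitting off the first tensor factor. -/
def consSplit (n m : ℕ) : (Fin (m + 1) → Fin n) ≃ (Fin 1 → Fin n) × (Fin m → Fin n) where
  toFun b := (fun _ => b 0, Fin.tail b)
  invFun b := Fin.cons (b.1 0) b.2
  left_inv b := Fin.cons_self_tail b
  right_inv b := Prod.ext (funext fun i => by rw [Subsingleton.elim i 0]; rfl) rfl

theorem wtAll_consSplit (b : Fin (m + 1) → Fin n) :
    wtAll b = wtAll (consSplit n m b).1 + wtAll (consSplit n m b).2 := by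
  simp [wtAll, wtOn, Fin.sum_univ_succ, consSplit, Fin.tail]

/-- The first label on the left, and all labels on the right. -/
def leftHead (m m' : ℕ) : Fin 1 ⊕ Fin m' → Fin (m + 1) ⊕ Fin m' := Sum.map (fun _ => 0) id

/-- All labels except the first on the left. -/
def leftTail (m m' : ℕ) : Fin m ⊕ Fin m' → Fin (m + 1) ⊕ Fin m' := Sum.map Fin.succ id

/-- The first label on the right, and all labels on the left. -/
def rightHead (m m' : ℕ) : Fin m ⊕ Fin 1 → Fin m ⊕ Fin (m' + 1) := Sum.map id fun _ => 0

/-- All labels except the first on the right. -/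
def rightTail (m m' : ℕ) : Fin m ⊕ Fin m' → Fin m ⊕ Fin (m' + 1) := Sum.map id Fin.succ

theorem leftHead_injective : Function.Injective (leftHead m m') :=
  Function.Injective.sumMap (fun _ _ _ => Subsingleton.elim _ _) Function.injective_id

theorem leftTail_injective : Function.Injective (leftTail m m') :=
  Function.Injective.sumMap (Fin.succ_injective m) Function.injective_id

theorem rightHead_injective : Function.Injective (rightHead m m') :=
  Function.Injective.sumMap Function.injective_id (fun _ _ _ => Subsingleton.elim _ _)

theorem rightTail_injective : Function.Injective (rightTail m m') :=
  Function.Injective.sumMap Function.injective_id (Fin.succ_injective m')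

/-- Between the two operators the left indices are forced: the head already has its final value `b'
0` and the tail still has its initial value. Only the shared right-hand indices `f` are summed. -/
theorem emb_leftHead_mul_emb_leftTail
    (P : Λ.Pt → Matrix (Fin 1 ⊕ Fin m' → Fin n) (Fin 1 ⊕ Fin m' → Fin n) ℂ)
    (Q : Λ.Pt → Matrix (Fin m ⊕ Fin m' → Fin n) (Fin m ⊕ Fin m' → Fin n) ℂ)
    (S S' : Finset (Fin (m + 1) ⊕ Fin m')) (x : Λ.Pt) (b b' : Fin (m + 1) → Fin n)
    (c c' : Fin m' → Fin n) :
    (emb (leftHead m m') S P * emb (leftTail m m') S' Q) x (Sum.elim b c) (Sum.elim b' c') =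
      ∑ f, P (shift (wtOn S (Sum.elim b c)) x) (Sum.elim (consSplit n m b).1 c)
          (Sum.elim (consSplit n m b').1 f) *
        Q (shift (wtOn S' (Sum.elim (Fin.cons (b' 0) (Fin.tail b) : Fin (m + 1) → Fin n) f)) x)
          (Sum.elim (consSplit n m b).2 f) (Sum.elim (consSplit n m b').2 c') := by
  classical
  rw [Pi.mul_apply, Matrix.mul_apply]
  symm
  have hoff₀ : ∀ y : Fin (m + 1) ⊕ Fin m' → Fin n,
      (∀ r, r ∉ Set.range (leftHead m m') → Sum.elim b c r = y r) ↔
        ∀ i : Fin m, b i.succ = y (.inl i.succ) := by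
    intro y
    constructor
    · intro h i
      refine h (.inl i.succ) ?_
      rintro ⟨j | j, hj⟩ <;> simp [leftHead, eq_comm] at hj
    · rintro h (r | r) hr
      · induction r using Fin.cases with
        | zero => exact absurd ⟨.inl 0, rfl⟩ hr
        | succ i => exact h i
      · exact absurd ⟨.inr r, rfl⟩ hr
  have hoff₁ : ∀ y : Fin (m + 1) ⊕ Fin m' → Fin n,
      (∀ r, r ∉ Set.range (leftTail m m') → y r = Sum.elim b' c' r) ↔ y (.inl 0) = b' 0 := by
    intro y
    constructor
    · intro h
      refine h (.inl 0) ?_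
      rintro ⟨j | j, hj⟩ <;> simp [leftTail] at hj
    · rintro h (r | r) hr
      · induction r using Fin.cases with
        | zero => exact h
        | succ i => exact absurd ⟨.inl i, rfl⟩ hr
      · exact absurd ⟨.inr r, rfl⟩ hr
  have hL : ∀ (y : Fin (m + 1) → Fin n) (z : Fin m' → Fin n),
      Sum.elim y z ∘ leftHead m m' = Sum.elim (consSplit n m y).1 z := by
    intro y z
    funext r
    rcases r with r | r <;> rfl
  have hT : ∀ (y : Fin (m + 1) → Fin n) (z : Fin m' → Fin n),
      Sum.elim y z ∘ leftTail m m' = Sum.elim (consSplit n m y).2 z := by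
    intro y z
    funext r
    rcases r with r | r <;> rfl
  refine Finset.sum_of_injOn
    (fun f => Sum.elim (Fin.cons (b' 0) (Fin.tail b) : Fin (m + 1) → Fin n) f) ?_ ?_ ?_ ?_
  · intro f _ g _ h
    exact congrArg (· ∘ Sum.inr) h
  · intro f _
    exact Finset.mem_coe.2 (Finset.mem_univ _)
  · intro y _ hy
    simp only [emb, Matrix.of_apply]
    by_cases h0 : ∀ i : Fin m, b i.succ = y (.inl i.succ)
    · by_cases h1 : y (.inl 0) = b' 0
      · refine absurd ⟨y ∘ Sum.inr, Finset.mem_coe.2 (Finset.mem_univ _), funext fun r => ?_⟩ hy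
        rcases r with r | r
        · induction r using Fin.cases with
          | zero => exact h1.symm
          | succ i => exact h0 i
        · rfl
      · rw [if_neg (fun h => h1 ((hoff₁ y).1 h)), mul_zero]
    · rw [if_neg (fun h => h0 ((hoff₀ y).1 h)), zero_mul]
  · intro f _
    simp only [emb, Matrix.of_apply]
    rw [if_pos ((hoff₀ _).2 fun i => rfl), if_pos ((hoff₁ _).2 rfl), hL, hL, hT, hT]
    rfl

/-- The mirror image: here the left-hand indices are shared and summed, while the right-hand ones
are forced. -/
theorem emb_rightHead_mul_emb_rightTail
    (P : Λ.Pt → Matrix (Fin m ⊕ Fin 1 → Fin n) (Fin m ⊕ Fin 1 → Fin n) ℂ)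
    (Q : Λ.Pt → Matrix (Fin m ⊕ Fin m' → Fin n) (Fin m ⊕ Fin m' → Fin n) ℂ)
    (S S' : Finset (Fin m ⊕ Fin (m' + 1))) (x : Λ.Pt) (b b' : Fin m → Fin n)
    (c c' : Fin (m' + 1) → Fin n) :
    (emb (rightHead m m') S P * emb (rightTail m m') S' Q) x (Sum.elim b c) (Sum.elim b' c') =
      ∑ f, P (shift (wtOn S (Sum.elim b c)) x) (Sum.elim b (consSplit n m' c).1)
          (Sum.elim f (consSplit n m' c').1) *
        Q (shift (wtOn S' (Sum.elim f (Fin.cons (c' 0) (Fin.tail c) : Fin (m' + 1) → Fin n))) x)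
          (Sum.elim f (consSplit n m' c).2) (Sum.elim b' (consSplit n m' c').2) := by
  classical
  rw [Pi.mul_apply, Matrix.mul_apply]
  symm
  have hoff₀ : ∀ y : Fin m ⊕ Fin (m' + 1) → Fin n,
      (∀ r, r ∉ Set.range (rightHead m m') → Sum.elim b c r = y r) ↔
        ∀ i : Fin m', c i.succ = y (.inr i.succ) := by
    intro y
    constructor
    · intro h i
      refine h (.inr i.succ) ?_
      rintro ⟨j | j, hj⟩ <;> simp [rightHead, eq_comm] at hj
    · rintro h (r | r) hr
      · exact absurd ⟨.inl r, rfl⟩ hr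
      · induction r using Fin.cases with
        | zero => exact absurd ⟨.inr 0, rfl⟩ hr
        | succ i => exact h i
  have hoff₁ : ∀ y : Fin m ⊕ Fin (m' + 1) → Fin n,
      (∀ r, r ∉ Set.range (rightTail m m') → y r = Sum.elim b' c' r) ↔ y (.inr 0) = c' 0 := by
    intro y
    constructor
    · intro h
      refine h (.inr 0) ?_
      rintro ⟨j | j, hj⟩ <;> simp [rightTail] at hj
    · rintro h (r | r) hr
      · exact absurd ⟨.inl r, rfl⟩ hr
      · induction r using Fin.cases with
        | zero => exact h
        | succ i => exact absurd ⟨.inr i, rfl⟩ hr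
  have hL : ∀ (y : Fin m → Fin n) (z : Fin (m' + 1) → Fin n),
      Sum.elim y z ∘ rightHead m m' = Sum.elim y (consSplit n m' z).1 := by
    intro y z
    funext r
    rcases r with r | r <;> rfl
  have hT : ∀ (y : Fin m → Fin n) (z : Fin (m' + 1) → Fin n),
      Sum.elim y z ∘ rightTail m m' = Sum.elim y (consSplit n m' z).2 := by
    intro y z
    funext r
    rcases r with r | r <;> rfl
  refine Finset.sum_of_injOn
    (fun f => Sum.elim f (Fin.cons (c' 0) (Fin.tail c) : Fin (m' + 1) → Fin n)) ?_ ?_ ?_ ?_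
  · intro f _ g _ h
    exact congrArg (· ∘ Sum.inl) h
  · intro f _
    exact Finset.mem_coe.2 (Finset.mem_univ _)
  · intro y _ hy
    simp only [emb, Matrix.of_apply]
    by_cases h0 : ∀ i : Fin m', c i.succ = y (.inr i.succ)
    · by_cases h1 : y (.inr 0) = c' 0
      · refine absurd ⟨y ∘ Sum.inl, Finset.mem_coe.2 (Finset.mem_univ _), funext fun r => ?_⟩ hy
        rcases r with r | r
        · rfl
        · induction r using Fin.cases with
          | zero => exact h1.symm
          | succ i => exact h0 i
      · rw [if_neg (fun h => h1 ((hoff₁ y).1 h)), mul_zero]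
    · rw [if_neg (fun h => h0 ((hoff₀ y).1 h)), zero_mul]
  · intro f _
    simp only [emb, Matrix.of_apply]
    rw [if_pos ((hoff₀ _).2 fun i => rfl), if_pos ((hoff₁ _).2 rfl), hL, hL, hT, hT]
    rfl

end

/-! ### Recursion of the fused `B` and `C` on the label sets -/

section

variable {n : ℕ} {γ : ℂ} {Λ : DynDomain n γ} {U : Type*} {m m' : ℕ}

theorem emb_list_prod {L L' I : Type*} [Fintype L] [DecidableEq L] [Fintype L'] [DecidableEq L']
    {ι : L' → L} (hι : Function.Injective ι) {S : Finset L} (hS : ∀ s, ι s ∉ S) (l : List I)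
    (f : I → Λ.Pt → Matrix (L' → Fin n) (L' → Fin n) ℂ) :
    emb ι S (l.map f).prod = (l.map fun i => emb ι S (f i)).prod := by
  have := map_list_prod (embHom ι hι S hS) (l.map f)
  rwa [List.map_map] at this

/-- Stated as a product of functions of the dynamical parameter, since `emb` shifts that parameter
and is a homomorphism only at this level. -/
theorem fuseB_eq_prod (R : StructMat Λ U) (M : Fin m → U) (N : Fin m' → U) :
    fuseB R M N = ((List.finRange m).map fun i => ((List.finRange m').map fun j =>
      site R (Sum.elim M N) (.inl i) (.inr j)
        ((Finset.Iio i).disjSum (Finset.Ioi j))).prod).prod := by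
  funext x
  simp only [fuseB, Pi.list_prod_apply, List.map_map, Function.comp_def]

theorem fuseC_eq_prod (R : StructMat Λ U) (M : Fin m → U) (N : Fin m' → U) :
    fuseC R M N = ((List.finRange m).map fun i => ((List.finRange m').map fun j =>
      site R (Sum.elim M N) (.inl i) (.inr j)
        ((Finset.Ioi i).disjSum (Finset.Iio j))).prod).prod := by
  funext x
  simp only [fuseC, Pi.list_prod_apply, List.map_map, Function.comp_def]

theorem leftHead_comp (M : Fin (m + 1) → U) (N : Fin m' → U) :
    (Sum.elim (fun _ : Fin 1 => M 0) N) = Sum.elim M N ∘ leftHead m m' := by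
  funext r
  rcases r with r | r <;> rfl

theorem leftTail_comp (M : Fin (m + 1) → U) (N : Fin m' → U) :
    (Sum.elim (Fin.tail M) N) = Sum.elim M N ∘ leftTail m m' := by
  funext r
  rcases r with r | r <;> rfl

theorem rightHead_comp (M : Fin m → U) (N : Fin (m' + 1) → U) :
    (Sum.elim M (fun _ : Fin 1 => N 0)) = Sum.elim M N ∘ rightHead m m' := by
  funext r
  rcases r with r | r <;> rfl

theorem rightTail_comp (M : Fin m → U) (N : Fin (m' + 1) → U) :
    (Sum.elim M (Fin.tail N)) = Sum.elim M N ∘ rightTail m m' := by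
  funext r
  rcases r with r | r <;> rfl

theorem fuseB_zero_left (R : StructMat Λ U) (M : Fin 0 → U) (N : Fin m' → U) :
    fuseB R M N = 1 := by
  funext x
  simp [fuseB]

theorem fuseB_zero_right (R : StructMat Λ U) (M : Fin m → U) (N : Fin 0 → U) :
    fuseB R M N = 1 := by
  funext x
  simp [fuseB]

theorem fuseB_apply_one (R : StructMat Λ U) (M N : Fin 1 → U) (x : Λ.Pt) (b c b' c' : Fin 1 → Fin n) :
    fuseB R M N x (Sum.elim b c) (Sum.elim b' c') =
      R (M 0) (N 0) x (b 0, c 0) (b' 0, c' 0) := by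
  have h : List.finRange 1 = [0] := rfl
  have h0 : Finset.Iio (0 : Fin 1) = ∅ := rfl
  simp [fuseB, site, h, h0]

/-- In `B` a row is shifted by the labels `k < i`: none for the first row, one extra `h` of the
first label for all the others. -/
theorem fuseB_cons_left (R : StructMat Λ U) (M : Fin (m + 1) → U) (N : Fin m' → U) :
    fuseB R M N = emb (leftHead m m') ∅ (fuseB R (fun _ : Fin 1 => M 0) N) *
      emb (leftTail m m') {.inl 0} (fuseB R (Fin.tail M) N) := by
  have h0 : ∀ s, leftHead m m' s ∉ (∅ : Finset (Fin (m + 1) ⊕ Fin m')) := by simp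
  have h1 : ∀ s, leftTail m m' s ∉ ({.inl 0} : Finset (Fin (m + 1) ⊕ Fin m')) := by
    rintro (s | s) <;> simp [leftTail]
  simp only [fuseB_eq_prod, emb_list_prod leftHead_injective h0,
    emb_list_prod leftTail_injective h1, leftHead_comp, leftTail_comp,
    emb_site leftHead_injective h0, emb_site leftTail_injective h1]
  rw [List.finRange_succ, List.map_cons, List.prod_cons, List.map_map]
  congr 1
  · rw [List.finRange_succ, List.finRange_zero, List.map_nil, List.map_cons, List.map_nil,
      List.prod_singleton]
    congr 2
    funext j
    congr 1
    ext (r | r)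
    · simp [leftHead]
    · simp [leftHead]
  · congr 2
    funext i
    rw [Function.comp_apply]
    congr 2
    funext j
    congr 1
    ext (r | r)
    · induction r using Fin.cases <;> simp [leftTail]
    · simp [leftTail]

theorem fuseC_zero_left (R : StructMat Λ U) (M : Fin 0 → U) (N : Fin m' → U) :
    fuseC R M N = 1 := by
  funext x
  simp [fuseC]

theorem fuseC_zero_right (R : StructMat Λ U) (M : Fin m → U) (N : Fin 0 → U) :
    fuseC R M N = 1 := by
  funext x
  simp [fuseC]

theorem fuseC_apply_one (R : StructMat Λ U) (M N : Fin 1 → U) (x : Λ.Pt) (b c b' c' : Fin 1 → Fin n) :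
    fuseC R M N x (Sum.elim b c) (Sum.elim b' c') =
      R (M 0) (N 0) x (b 0, c 0) (b' 0, c' 0) := by
  have h : List.finRange 1 = [0] := rfl
  have h0 : Finset.Iio (0 : Fin 1) = ∅ := rfl
  simp [fuseC, site, h, h0]

/-- In `C` the shift is by `k > i`, so it is the first row that is shifted, by the whole tail. -/
theorem fuseC_cons_left (R : StructMat Λ U) (M : Fin (m + 1) → U) (N : Fin m' → U) :
    fuseC R M N = emb (leftHead m m') ((Finset.Ioi 0).disjSum ∅)
        (fuseC R (fun _ : Fin 1 => M 0) N) *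
      emb (leftTail m m') ∅ (fuseC R (Fin.tail M) N) := by
  have h0 : ∀ s, leftHead m m' s ∉ (Finset.Ioi (0 : Fin (m + 1))).disjSum (∅ : Finset (Fin m')) := by
    rintro (s | s) <;> simp [leftHead]
  have h1 : ∀ s, leftTail m m' s ∉ (∅ : Finset (Fin (m + 1) ⊕ Fin m')) := by simp
  simp only [fuseC_eq_prod, emb_list_prod leftHead_injective h0,
    emb_list_prod leftTail_injective h1, leftHead_comp, leftTail_comp,
    emb_site leftHead_injective h0, emb_site leftTail_injective h1]
  rw [List.finRange_succ, List.map_cons, List.prod_cons, List.map_map]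
  congr 1
  · rw [List.finRange_succ, List.finRange_zero, List.map_nil, List.map_cons, List.map_nil,
      List.prod_singleton]
    congr 2
    funext j
    congr 1
    ext (r | r)
    · simp [leftHead]
    · simp [leftHead]
  · congr 2
    funext i
    rw [Function.comp_apply]
    congr 2
    funext j
    congr 1
    ext (r | r)
    · induction r using Fin.cases <;> simp [leftTail]
    · simp [leftTail]

/-- One row suffices, because rows are assembled by `fuseB_cons_left`; with a single row no factors
need to be reordered. -/
theorem fuseB_cons_right (R : StructMat Λ U) (M : Fin 1 → U) (N : Fin (m' + 1) → U) :
    fuseB R M N = emb (rightHead 1 m') ((∅ : Finset (Fin 1)).disjSum (Finset.Ioi 0))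
        (fuseB R M (fun _ : Fin 1 => N 0)) *
      emb (rightTail 1 m') ∅ (fuseB R M (Fin.tail N)) := by
  have h0 : ∀ s, rightHead 1 m' s ∉
      (∅ : Finset (Fin 1)).disjSum (Finset.Ioi (0 : Fin (m' + 1))) := by
    rintro (s | s) <;> simp [rightHead]
  have h1 : ∀ s, rightTail 1 m' s ∉ (∅ : Finset (Fin 1 ⊕ Fin (m' + 1))) := by simp
  simp only [fuseB_eq_prod, emb_list_prod rightHead_injective h0,
    emb_list_prod rightTail_injective h1, rightHead_comp, rightTail_comp,
    emb_site rightHead_injective h0, emb_site rightTail_injective h1]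
  rw [List.finRange_succ (n := 0), List.finRange_zero, List.map_nil]
  simp only [List.map_cons, List.map_nil, List.prod_singleton]
  rw [List.finRange_succ, List.map_cons, List.prod_cons, List.map_map]
  congr 1
  · congr 1
    ext (r | r)
    · simp [rightHead]
    · simp [rightHead]
  · congr 2
    funext j
    rw [Function.comp_apply]
    congr 1
    ext (r | r)
    · simp [rightTail]
    · induction r using Fin.cases <;> simp [rightTail]

theorem fuseC_cons_right (R : StructMat Λ U) (M : Fin 1 → U) (N : Fin (m' + 1) → U) :
    fuseC R M N = emb (rightHead 1 m') ∅ (fuseC R M (fun _ : Fin 1 => N 0)) *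
      emb (rightTail 1 m') {.inr 0} (fuseC R M (Fin.tail N)) := by
  have h0 : ∀ s, rightHead 1 m' s ∉ (∅ : Finset (Fin 1 ⊕ Fin (m' + 1))) := by simp
  have h1 : ∀ s, rightTail 1 m' s ∉ ({.inr 0} : Finset (Fin 1 ⊕ Fin (m' + 1))) := by
    rintro (s | s) <;> simp [rightTail]
  simp only [fuseC_eq_prod, emb_list_prod rightHead_injective h0,
    emb_list_prod rightTail_injective h1, rightHead_comp, rightTail_comp,
    emb_site rightHead_injective h0, emb_site rightTail_injective h1]
  rw [List.finRange_succ (n := 0), List.finRange_zero, List.map_nil]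
  simp only [List.map_cons, List.map_nil, List.prod_singleton]
  rw [List.finRange_succ, List.map_cons, List.prod_cons, List.map_map]
  congr 3
  funext j
  rw [Function.comp_apply]
  congr 1
  ext (r | r)
  · simp [rightTail]
  · induction r using Fin.cases <;> simp [rightTail]

/-! ### Crossing relations of the fused matrices -/

/-- The four-index form of a matrix on `V^{⊗ I} ⊗ V^{⊗ J}`. -/
def curryMat {I J : Type*} (X : Λ.Pt → Matrix (I ⊕ J → Fin n) (I ⊕ J → Fin n) ℂ) :
    Λ.Pt → (I → Fin n) → (J → Fin n) → (I → Fin n) → (J → Fin n) → ℂ :=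
  fun x b c b' c' => X x (Sum.elim b c) (Sum.elim b' c')

/-- The four-index form of a matrix on `V^{⊗ I} ⊗ V^{⊗ J}`, with the two factors exchanged. -/
def curryMatSwap {I J : Type*} (X : Λ.Pt → Matrix (I ⊕ J → Fin n) (I ⊕ J → Fin n) ℂ) :
    Λ.Pt → (J → Fin n) → (I → Fin n) → (J → Fin n) → (I → Fin n) → ℂ :=
  fun x c b c' b' => X x (Sum.elim b c) (Sum.elim b' c')

theorem crossInv_one {I J : Type*} [Fintype I] [Fintype J] [DecidableEq I] [DecidableEq J] :
    CrossInv wtAll (curryMat (Λ := Λ) (I := I) (J := J) 1) (curryMat 1) := by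
  classical
  intro z b c' b₁ c₁
  simp only [curryMat, Pi.one_apply, Matrix.one_apply]
  have h : ∀ (p p' : I → Fin n) (q q' : J → Fin n),
      Sum.elim p q = Sum.elim p' q' ↔ p = p' ∧ q = q' := by
    intro p p' q q'
    exact Sum.elim_eq_iff
  simp only [h]
  rw [Finset.sum_eq_single c', Finset.sum_eq_single b]
  · simp only [and_self, if_true, one_mul]
    by_cases hh : b = b₁ ∧ c' = c₁
    · rw [if_pos hh, if_pos ⟨hh.1.symm, hh.2⟩]
    · rw [if_neg hh, if_neg fun h' => hh ⟨h'.1.symm, h'.2⟩]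
  · intro y _ hy
    rw [if_neg fun hh => hy hh.1.symm, zero_mul]
  · simp
  · intro y _ hy
    refine Finset.sum_eq_zero fun y' _ => ?_
    rw [if_neg fun hh => hy hh.2, zero_mul]
  · simp

theorem crossInvSwap_one {I J : Type*} [Fintype I] [Fintype J] [DecidableEq I] [DecidableEq J] :
    CrossInv wtAll (curryMatSwap (Λ := Λ) (n := n) (I := I) (J := J) 1) (curryMatSwap 1) := by
  classical
  intro z b c' b₁ c₁
  have := crossInv_one (Λ := Λ) (I := J) (J := I) z b c' b₁ c₁
  rw [← this]
  simp only [curryMat, curryMatSwap, Pi.one_apply, Matrix.one_apply, Sum.elim_eq_iff, and_comm]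

theorem wtAll_fin_one (b : Fin 1 → Fin n) : wtAll b = wt (b 0) := by
  simp [wtAll, wtOn]

theorem sum_fin_one_sum_fin_one (f : Fin n → Fin n → ℂ) :
    ∑ c : Fin 1 → Fin n, ∑ b : Fin 1 → Fin n, f (b 0) (c 0) = ∑ p : Fin n × Fin n, f p.1 p.2 := by
  rw [Fintype.sum_prod_type', Finset.sum_comm]
  refine Fintype.sum_equiv (Equiv.funUnique (Fin 1) (Fin n)) _ _ fun b => ?_
  exact Fintype.sum_equiv (Equiv.funUnique (Fin 1) (Fin n)) _ _ fun c => rfl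

theorem ite_fin_one_eq (b c b₁ c₁ : Fin 1 → Fin n) [Decidable (b = b₁ ∧ c = c₁)] :
    (if b = b₁ ∧ c = c₁ then (1 : ℂ) else 0) =
      (1 : Matrix (Fin n × Fin n) (Fin n × Fin n) ℂ) (b 0, c 0) (b₁ 0, c₁ 0) := by
  rw [Matrix.one_apply]
  refine if_congr ?_ rfl rfl
  have h : ∀ p q : Fin 1 → Fin n, p = q ↔ p 0 = q 0 := fun p q =>
    ⟨fun h => h ▸ rfl, fun h => funext fun i => by rwa [Subsingleton.elim i 0]⟩
  rw [h, h, Prod.mk.injEq]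

/-- The shifts in `crossB` add up to `wt c' - wt b - wt c`, which is `-wt b'` by zero weight. This
is the shift that occurs in `CrossInv`. -/
theorem crossB_apply {R : StructMat Λ U} (hw : ZeroWeight R) (u v : U) (z : Λ.Pt)
    (b c b' c' : Fin n) :
    crossB R u v z (b, c') (b', c) = R u v (shift (-wt b') z) (b, c) (b', c') := by
  simp only [crossB, transp₂, colShift, lineShift, Matrix.of_apply, shift_shift]
  by_cases h : wt b + wt c = wt b' + wt c'
  · congr 2
    simp only [neg_smul, one_smul, zero_smul, zero_add, neg_neg]
    rw [← neg_add, h]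
    abel
  · exact (not_not.1 fun h' => h (hw.wt_eq h')).trans (not_not.1 fun h' => h (hw.wt_eq h')).symm

theorem crossC_apply {R : StructMat Λ U} (hw : ZeroWeight R) (u v : U) (z : Λ.Pt)
    (b c b' c' : Fin n) :
    crossC R u v z (b', c) (b, c') = R u v (shift (-wt c') z) (b, c) (b', c') := by
  simp only [crossC, transp₁, colShift, lineShift, Matrix.of_apply, shift_shift]
  by_cases h : wt b + wt c = wt b' + wt c'
  · congr 2
    simp only [neg_smul, one_smul, zero_smul, add_zero, neg_neg]
    rw [← neg_add, h]
    abel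
  · exact (not_not.1 fun h' => h (hw.wt_eq h')).trans (not_not.1 fun h' => h (hw.wt_eq h')).symm

theorem crossInv_fuseB_one {R : StructMat Λ U} (hw : ZeroWeight R)
    (hu : ∀ u v x, IsUnit (crossB R u v x)) (M N : Fin 1 → U) :
    CrossInv wtAll (curryMat (fuseB R M N)) (curryMat (fuseB (dualB R) M N)) := by
  classical
  intro z b c' b₁ c₁
  simp only [curryMat, fuseB_apply_one, wtAll_fin_one]
  rw [ite_fin_one_eq, ← Matrix.mul_nonsing_inv _
    ((Matrix.isUnit_iff_isUnit_det _).1 (hu (M 0) (N 0) z)), Matrix.mul_apply]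
  rw [sum_fin_one_sum_fin_one fun b' c =>
    R (M 0) (N 0) (shift (-wt b') z) (b 0, c) (b', c' 0) *
      dualB R (M 0) (N 0) (shift (-wt b') z) (b₁ 0, c) (b', c₁ 0)]
  refine Finset.sum_congr rfl fun p _ => ?_
  rw [← crossB_apply hw]
  congr 1
  -- The shift by `-wt b'` cancels the final `SL₁` of the dual, leaving an entry of the inverse at
  -- `z`.
  simp [dualB, transp₁, lineShift, invMat, shift_shift]

theorem crossInv_fuseC_one {R : StructMat Λ U} (hw : ZeroWeight R)
    (hu : ∀ u v x, IsUnit (crossC R u v x)) (M N : Fin 1 → U) :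
    CrossInv wtAll (curryMatSwap (fuseC R M N)) (curryMatSwap (fuseC (dualC R) M N)) := by
  classical
  intro z d a' d₁ a₁
  simp only [curryMatSwap, fuseC_apply_one, wtAll_fin_one]
  simp only [and_comm (a := d = d₁)]
  rw [ite_fin_one_eq, ← Matrix.mul_nonsing_inv _
    ((Matrix.isUnit_iff_isUnit_det _).1 (hu (M 0) (N 0) z)), Matrix.mul_apply, Finset.sum_comm]
  rw [sum_fin_one_sum_fin_one fun a d' =>
    R (M 0) (N 0) (shift (-wt d') z) (a, d 0) (a' 0, d') *
      dualC R (M 0) (N 0) (shift (-wt d') z) (a, d₁ 0) (a₁ 0, d')]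
  refine Finset.sum_congr rfl fun p _ => ?_
  rw [← crossC_apply hw]
  congr 1
  simp [dualC, transp₂, lineShift, invMat, shift_shift]

theorem PreservesWt.sumElim {I J : Type*} [Fintype I] [Fintype J]
    {X : Matrix (I ⊕ J → Fin n) (I ⊕ J → Fin n) ℂ} (hX : PreservesWt X) {b b' : I → Fin n}
    {c c' : J → Fin n} (h : X (Sum.elim b c) (Sum.elim b' c') ≠ 0) :
    wtAll b + wtAll c = wtAll b' + wtAll c' := by
  rw [← wtAll_sumElim, ← wtAll_sumElim]
  exact hX _ _ h

theorem wtAll_tail (b : Fin (m + 1) → Fin n) :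
    ∑ i ∈ Finset.Ioi 0, wt (b i) = wtAll (consSplit n m b).2 := by
  rw [Fin.sum_Ioi_zero]
  rfl

theorem wtOn_right_tail {I : Type*} (b : I → Fin n) (c : Fin (m + 1) → Fin n) :
    wtOn ((∅ : Finset I).disjSum (Finset.Ioi 0)) (Sum.elim b c) = wtAll (consSplit n m c).2 := by
  rw [wtOn, Finset.sum_disjSum]
  simpa using wtAll_tail c

theorem wtOn_left_tail {J : Type*} (b : Fin (m + 1) → Fin n) (c : J → Fin n) :
    wtOn ((Finset.Ioi 0).disjSum (∅ : Finset J)) (Sum.elim b c) = wtAll (consSplit n m b).2 := by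
  rw [wtOn, Finset.sum_disjSum]
  simpa using wtAll_tail b

theorem wtOn_singleton {L : Type*} (p : L) (a : L → Fin n) : wtOn {p} a = wt (a p) := by
  simp [wtOn]

theorem crossInv_fuseB_row {R : StructMat Λ U} (hw : ZeroWeight R)
    (hu : ∀ u v x, IsUnit (crossB R u v x)) (M : Fin 1 → U) (N : Fin m' → U) :
    CrossInv wtAll (curryMat (fuseB R M N)) (curryMat (fuseB (dualB R) M N)) := by
  induction m' with
  | zero =>
    rw [fuseB_zero_right, fuseB_zero_right]
    exact crossInv_one
  | succ m' ih =>
    refine (crossInv_fuseB_one hw hu M fun _ => N 0).comp_right (ih (Fin.tail N)) (v₁ := wtAll)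
      (fun x b c b' c' h => (hw.fuseB _ _ x).sumElim h) (consSplit n m') ?_ ?_ <;>
    · intro x b c b' c'
      rw [curryMat, fuseB_cons_right, emb_rightHead_mul_emb_rightTail]
      simp only [wtOn_empty, shift_zero, wtOn_right_tail]
      rfl

/-- Rows are built by composition in the second factor and stacked by composition in the first,
matching the shifts `l > j` and `k < i` of the fused `B`. -/
theorem crossInv_fuseB {R : StructMat Λ U} (hw : ZeroWeight R)
    (hu : ∀ u v x, IsUnit (crossB R u v x)) (M : Fin m → U) (N : Fin m' → U) :
    CrossInv wtAll (curryMat (fuseB R M N)) (curryMat (fuseB (dualB R) M N)) := by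
  induction m with
  | zero =>
    rw [fuseB_zero_left, fuseB_zero_left]
    exact crossInv_one
  | succ m ih =>
    refine (crossInv_fuseB_row hw hu (fun _ => M 0) N).comp_left (ih (Fin.tail M))
      (consSplit n m) wtAll_consSplit ?_ ?_ <;>
    · intro x b c b' c'
      rw [curryMat, fuseB_cons_left, emb_leftHead_mul_emb_leftTail]
      simp only [wtOn_empty, shift_zero, wtOn_singleton, wtAll_fin_one]
      rfl

/-- In `C` the shifts are `l < j` and `k > i`, so the two tensor factors exchange roles: after the
swap, `N'` composes on the left and `M` on the right. -/
theorem crossInv_fuseC_row {R : StructMat Λ U} (hw : ZeroWeight R)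
    (hu : ∀ u v x, IsUnit (crossC R u v x)) (M : Fin 1 → U) (N : Fin m' → U) :
    CrossInv wtAll (curryMatSwap (fuseC R M N)) (curryMatSwap (fuseC (dualC R) M N)) := by
  induction m' with
  | zero =>
    rw [fuseC_zero_right, fuseC_zero_right]
    exact crossInvSwap_one
  | succ m' ih =>
    refine (crossInv_fuseC_one hw hu M fun _ => N 0).comp_left (ih (Fin.tail N))
      (consSplit n m') wtAll_consSplit ?_ ?_ <;>
    · intro x b c b' c'
      rw [curryMatSwap, fuseC_cons_right, emb_rightHead_mul_emb_rightTail]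
      simp only [wtOn_empty, shift_zero, wtOn_singleton, wtAll_fin_one]
      rfl

theorem crossInv_fuseC {R : StructMat Λ U} (hw : ZeroWeight R)
    (hu : ∀ u v x, IsUnit (crossC R u v x)) (M : Fin m → U) (N : Fin m' → U) :
    CrossInv wtAll (curryMatSwap (fuseC R M N)) (curryMatSwap (fuseC (dualC R) M N)) := by
  induction m with
  | zero =>
    rw [fuseC_zero_left, fuseC_zero_left]
    exact crossInvSwap_one
  | succ m ih =>
    refine (crossInv_fuseC_row hw hu (fun _ => M 0) N).comp_right (ih (Fin.tail M)) (v₁ := wtAll)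
      (fun x b c b' c' h => ?_) (consSplit n m) ?_ ?_
    · rw [add_comm, (hw.fuseC _ _ x).sumElim h, add_comm]
    all_goals
      intro x b c b' c'
      rw [curryMatSwap, fuseC_cons_left, emb_leftHead_mul_emb_leftTail]
      simp only [wtOn_empty, shift_zero, wtOn_left_tail]
      rfl

end

section

variable {n : ℕ} {γ : ℂ} {Λ : DynDomain n γ} {U : Type*} {m m' : ℕ}
  {W W' : Type*} [AddCommGroup W] [Module ℂ W] [AddCommGroup W'] [Module ℂ W']

/-! ### The difference operator of a pair of matrices -/

/-- `∑_{p,q} e^{-γ ∂_p} (X_{pq} ⊗ Y_{pq}) e^{γ ∂_q}` applied to `f`. -/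
def pairing {P : Type*} [Fintype P] (w : P → Fin n → ℤ) (X : Λ.Pt → Matrix P P (Module.End ℂ W))
    (Y : Λ.Pt → Matrix P P (Module.End ℂ W')) (f : Λ.Pt → W ⊗[ℂ] W') (x : Λ.Pt) : W ⊗[ℂ] W' :=
  ∑ p, ∑ q, TensorProduct.map (X (shift (-w p) x) p q) (Y (shift (-w p) x) p q)
    (f (shift (w q) (shift (-w p) x)))

/-- The column shift on `K` is undone by `e^{γ∂_b}` standing to its left, so `T` and `K` end up at
the same point. -/
theorem hamiltonian_apply (T : AuxMat Λ m W) (K : AuxMat Λ m W') (f : Λ.Pt → W ⊗[ℂ] W') :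
    hamiltonian T K f = pairing wtAll T K f := by
  funext x
  simp only [hamiltonian, Matrix.trace, Matrix.diag, expD, Matrix.mul_apply (N := (opMat _)ᵀ),
    Matrix.mul_diagonal, Matrix.diagonal_mul, LinearMap.sum_apply, Finset.sum_apply, pairing]
  refine Finset.sum_congr rfl fun a _ => Finset.sum_congr rfl fun b _ => ?_
  simp only [Module.End.mul_apply, opMat, mulOp, shiftOp, onQ, onQ', colShiftAux,
    Matrix.transpose_apply, Matrix.of_apply, LinearMap.funLeft_apply, LinearMap.pi_apply,
    LinearMap.comp_apply, LinearMap.proj_apply, Matrix.map_apply, neg_smul, one_smul]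
  have h : ∀ y : Λ.Pt, shift (-wtAll b) (shift (wtAll b) y) = y := fun y => by
    rw [shift_shift, neg_add_cancel, shift_zero]
  rw [h, ← LinearMap.comp_apply, LinearMap.rTensor_comp_lTensor]

theorem tensorMap_sum_smul {I : Type*} [Fintype I] (c d : I → ℂ) (F : I → Module.End ℂ W)
    (G : I → Module.End ℂ W') (t : W ⊗[ℂ] W') :
    TensorProduct.map (∑ i, c i • F i) (∑ j, d j • G j) t =
      ∑ i, ∑ j, (c i * d j) • TensorProduct.map (F i) (G j) t := by
  have h : ∀ (A : Module.End ℂ W) (B : Module.End ℂ W'), TensorProduct.map A B =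
    TensorProduct.mapBilinear (RingHom.id ℂ) W W' W W' A B := fun _ _ => rfl
  simp only [h, map_sum, map_smul, LinearMap.sum_apply, LinearMap.smul_apply, smul_smul,
    Finset.smul_sum]
  rw [Finset.sum_comm]
  refine Finset.sum_congr rfl fun i _ => Finset.sum_congr rfl fun j _ => ?_
  rw [mul_comm]

theorem scal_mul_apply {P : Type*} [Fintype P] (A : Matrix P P ℂ)
    (X : Matrix P P (Module.End ℂ W)) (p q : P) : (scal W A * X) p q = ∑ r, A p r • X r q := by
  simp only [Matrix.mul_apply, scal, Matrix.map_apply, Algebra.smul_def]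

theorem mul_scal_apply {P : Type*} [Fintype P] (A : Matrix P P ℂ)
    (X : Matrix P P (Module.End ℂ W)) (p q : P) : (X * scal W A) p q = ∑ r, A r q • X p r := by
  simp only [Matrix.mul_apply, scal, Matrix.map_apply, Algebra.smul_def, Algebra.commutes]

/-! ### Removing weight-preserving scalar matrices from a pairing -/

section

variable {P : Type*} [Fintype P] [DecidableEq P] {w : P → Fin n → ℤ} {A A' : Λ.Pt → Matrix P P ℂ}

/-- The shift depends on the row `p` only through its weight, which `A` conserves. The sum over `p`
therefore takes place at a fixed point and produces `Aᵗ A'`. -/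
theorem pairing_scal_mul (hA : ∀ x p q, A x p q ≠ 0 → w p = w q)
    (h : ∀ x, (A x)ᵀ * A' x = 1) (X : Λ.Pt → Matrix P P (Module.End ℂ W))
    (Y : Λ.Pt → Matrix P P (Module.End ℂ W')) (f : Λ.Pt → W ⊗[ℂ] W') :
    pairing w (fun x => scal W (A x) * X x) (fun x => scal W' (A' x) * Y x) f =
      pairing w X Y f := by
  funext x
  have key : ∀ p q r s, (A (shift (-w p) x) p r * A' (shift (-w p) x) p s) •
      TensorProduct.map (X (shift (-w p) x) r q) (Y (shift (-w p) x) s q)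
        (f (shift (w q) (shift (-w p) x))) =
      ((A (shift (-w r) x))ᵀ r p * A' (shift (-w r) x) p s) •
      TensorProduct.map (X (shift (-w r) x) r q) (Y (shift (-w r) x) s q)
        (f (shift (w q) (shift (-w r) x))) := by
    intro p q r s
    rw [Matrix.transpose_apply]
    by_cases hpr : w p = w r
    · rw [hpr]
    · have h0 : ∀ y, A y p r = 0 := fun y => not_not.1 fun hne => hpr (hA y p r hne)
      rw [h0, h0, zero_mul, zero_mul, zero_smul, zero_smul]
  simp only [pairing, scal_mul_apply, tensorMap_sum_smul, key]
  rw [Finset.sum_congr rfl fun p _ => Finset.sum_comm, Finset.sum_comm]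
  refine Finset.sum_congr rfl fun r _ => ?_
  rw [Finset.sum_comm]
  refine Finset.sum_congr rfl fun q _ => ?_
  rw [Finset.sum_comm]
  simp only [← Finset.sum_smul, ← Matrix.mul_apply, h, Matrix.one_apply, ite_smul, one_smul,
    zero_smul, Finset.sum_ite_eq, Finset.mem_univ, if_true]

/-- Here the summed index is the column, which enters only through the argument of `f`; conservation
of weight fixes that argument and the sum produces `A A'ᵗ`. -/
theorem pairing_mul_scal (hA : ∀ x p q, A x p q ≠ 0 → w p = w q)
    (h : ∀ x, A x * (A' x)ᵀ = 1) (X : Λ.Pt → Matrix P P (Module.End ℂ W))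
    (Y : Λ.Pt → Matrix P P (Module.End ℂ W')) (f : Λ.Pt → W ⊗[ℂ] W') :
    pairing w (fun x => X x * scal W (A x)) (fun x => Y x * scal W' (A' x)) f =
      pairing w X Y f := by
  funext x
  have key : ∀ p q r s, (A (shift (-w p) x) r q * A' (shift (-w p) x) s q) •
      TensorProduct.map (X (shift (-w p) x) p r) (Y (shift (-w p) x) p s)
        (f (shift (w q) (shift (-w p) x))) =
      (A (shift (-w p) x) r q * (A' (shift (-w p) x))ᵀ q s) •
      TensorProduct.map (X (shift (-w p) x) p r) (Y (shift (-w p) x) p s)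
        (f (shift (w r) (shift (-w p) x))) := by
    intro p q r s
    rw [Matrix.transpose_apply]
    by_cases hrq : w r = w q
    · rw [hrq]
    · have h0 : ∀ y, A y r q = 0 := fun y => not_not.1 fun hne => hrq (hA y r q hne)
      rw [h0, zero_mul, zero_smul, zero_smul]
  simp only [pairing, mul_scal_apply, tensorMap_sum_smul, key]
  refine Finset.sum_congr rfl fun p _ => ?_
  rw [Finset.sum_comm]
  refine Finset.sum_congr rfl fun r _ => ?_
  rw [Finset.sum_comm]
  simp only [← Finset.sum_smul, ← Matrix.mul_apply, h, Matrix.one_apply, ite_smul, one_smul,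
    zero_smul, Finset.sum_ite_eq, Finset.mem_univ, if_true]

end

/-- The composition of two difference operators, with a matrix satisfying the crossing relation and
its dual inserted. -/
theorem pairing_pairing {α β : Type*} [Fintype α] [Fintype β] {w : α → Fin n → ℤ}
    {v : β → Fin n → ℤ} {B B' : Λ.Pt → α → β → α → β → ℂ} (h : CrossInv w B B')
    (hB : ∀ x b c b' c', B x b c b' c' ≠ 0 → w b + v c = w b' + v c')
    (X : Λ.Pt → Matrix α α (Module.End ℂ W)) (X' : Λ.Pt → Matrix α α (Module.End ℂ W'))
    (Y : Λ.Pt → Matrix β β (Module.End ℂ W)) (Y' : Λ.Pt → Matrix β β (Module.End ℂ W'))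
    (f : Λ.Pt → W ⊗[ℂ] W') (x : Λ.Pt) :
    pairing w X X' (pairing v Y Y' f) x = ∑ a, ∑ c, ∑ b', ∑ d,
      TensorProduct.map
        (∑ k : α × β, B (shift (-(w a + v c)) x) k.1 c b' k.2 •
          (X (shift (v c) (shift (-(w a + v c)) x)) a k.1 *
            Y (shift (w b') (shift (-(w a + v c)) x)) k.2 d))
        (∑ k : α × β, B' (shift (-(w a + v c)) x) k.1 c b' k.2 •
          (X' (shift (v c) (shift (-(w a + v c)) x)) a k.1 *
            Y' (shift (w b') (shift (-(w a + v c)) x)) k.2 d))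
        (f (shift (w b' + v d) (shift (-(w a + v c)) x))) := by
  classical
  rw [pairing]
  refine Finset.sum_congr rfl fun a _ => ?_
  have h1 : ∀ c, shift (v c) (shift (-(w a + v c)) x) = shift (-w a) x := fun c => by
    rw [shift_shift]
    congr 1
    abel
  have h2 : ∀ c, shift (-(w a + v c)) x = shift (-v c) (shift (-w a) x) := fun c => by
    rw [shift_shift]
    congr 1
    abel
  simp only [h1]
  simp only [h2]
  clear h1 h2
  generalize shift (-w a) x = z
  -- Where `B` is nonzero, `w b' - v c = w k.1 - v k.2`. So `Y`, `Y'` and `f` are evaluated at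
  -- points free of `c` and `b'`, and the sum over these two is the crossing relation at `z` shifted
  -- by `w k.1 - v k.2`.
  have key : ∀ c b' d (k l : α × β), (B (shift (-v c) z) k.1 c b' k.2 *
        B' (shift (-v c) z) l.1 c b' l.2) •
      TensorProduct.map (X z a k.1 * Y (shift (w b') (shift (-v c) z)) k.2 d)
        (X' z a l.1 * Y' (shift (w b') (shift (-v c) z)) l.2 d)
        (f (shift (w b' + v d) (shift (-v c) z))) =
      (B (shift (-w b') (shift (-v k.2) (shift (w k.1) z))) k.1 c b' k.2 *
        B' (shift (-w b') (shift (-v k.2) (shift (w k.1) z))) l.1 c b' l.2) •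
      TensorProduct.map (X z a k.1 * Y (shift (-v k.2) (shift (w k.1) z)) k.2 d)
        (X' z a l.1 * Y' (shift (-v k.2) (shift (w k.1) z)) l.2 d)
        (f (shift (v d) (shift (-v k.2) (shift (w k.1) z)))) := by
    intro c b' d k l
    by_cases hk : w k.1 + v c = w b' + v k.2
    · have e0 : w b' = w k.1 + v c - v k.2 := by rw [hk]; abel
      have e1 : shift (-w b') (shift (-v k.2) (shift (w k.1) z)) = shift (-v c) z := by
        rw [shift_shift, shift_shift, e0]
        congr 1
        abel
      have e2 : shift (w b') (shift (-v c) z) = shift (-v k.2) (shift (w k.1) z) := by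
        rw [shift_shift, shift_shift, e0]
        congr 1
        abel
      rw [e1, add_comm (w b'), ← shift_shift (v d), e2]
    · have h0 : ∀ y, B y k.1 c b' k.2 = 0 := fun y => not_not.1 fun hne => hk (hB _ _ _ _ _ hne)
      rw [h0, h0, zero_mul, zero_mul, zero_smul, zero_smul]
  simp only [tensorMap_sum_smul, key]
  calc _ = ∑ k : α × β, ∑ d, ∑ l : α × β,
        (if k.1 = l.1 ∧ k.2 = l.2 then (1 : ℂ) else 0) •
          TensorProduct.map (X z a k.1 * Y (shift (-v k.2) (shift (w k.1) z)) k.2 d)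
            (X' z a l.1 * Y' (shift (-v k.2) (shift (w k.1) z)) l.2 d)
            (f (shift (v d) (shift (-v k.2) (shift (w k.1) z)))) := by
        rw [Fintype.sum_prod_type]
        refine Finset.sum_congr rfl fun b _ => ?_
        rw [pairing, map_sum]
        refine Finset.sum_congr rfl fun c' _ => ?_
        rw [map_sum]
        refine Finset.sum_congr rfl fun d _ => ?_
        simp only [ite_smul, one_smul, zero_smul]
        rw [Finset.sum_eq_single (b, c')]
        · rw [if_pos ⟨rfl, rfl⟩, TensorProduct.map_mul]
          rfl
        · intro l _ hl
          exact if_neg fun hh => hl (Prod.ext hh.1.symm hh.2.symm)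
        · simp
    _ = ∑ k : α × β, ∑ d, ∑ l : α × β, ∑ c, ∑ b',
        (B (shift (-w b') (shift (-v k.2) (shift (w k.1) z))) k.1 c b' k.2 *
          B' (shift (-w b') (shift (-v k.2) (shift (w k.1) z))) l.1 c b' l.2) •
        TensorProduct.map (X z a k.1 * Y (shift (-v k.2) (shift (w k.1) z)) k.2 d)
          (X' z a l.1 * Y' (shift (-v k.2) (shift (w k.1) z)) l.2 d)
          (f (shift (v d) (shift (-v k.2) (shift (w k.1) z)))) := by
        refine Finset.sum_congr rfl fun k _ => Finset.sum_congr rfl fun d _ =>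
          Finset.sum_congr rfl fun l _ => ?_
        simp only [← Finset.sum_smul]
        rw [h]
    _ = _ := by
        rw [Finset.sum_comm, Finset.sum_congr rfl fun d _ => Finset.sum_congr rfl fun k _ =>
          Finset.sum_comm, Finset.sum_congr rfl fun d _ => Finset.sum_comm, Finset.sum_comm]
        refine Finset.sum_congr rfl fun c _ => ?_
        rw [Finset.sum_congr rfl fun d _ => Finset.sum_congr rfl fun k _ =>
          Finset.sum_comm, Finset.sum_congr rfl fun d _ => Finset.sum_comm, Finset.sum_comm]

/-! ### Products of matrices on two groups of tensor factors -/

theorem sum_sumElim {I J A : Type*} [Fintype I] [Fintype J] [DecidableEq I] [DecidableEq J]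
    [AddCommMonoid A] (F : (I ⊕ J → Fin n) → A) :
    ∑ y, F y = ∑ b, ∑ c, F (Sum.elim b c) := by
  rw [← Fintype.sum_prod_type']
  refine Fintype.sum_equiv (Equiv.sumArrowEquivProdArrow I J (Fin n)) _ _ fun y => ?_
  exact congrArg F (Sum.elim_comp_inl_inr y).symm

theorem onLeft_apply (T : AuxMat Λ m W) (x : Λ.Pt) (a b : Fin m → Fin n) (c d : Fin m' → Fin n) :
    onLeft T x (Sum.elim a c) (Sum.elim b d) =
      if c = d then T (shift (wtAll c) x) a b else 0 :=
  if_congr Iff.rfl rfl rfl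

theorem onRight_apply (T : AuxMat Λ m' W) (x : Λ.Pt) (a b : Fin m → Fin n)
    (c d : Fin m' → Fin n) :
    onRight T x (Sum.elim a c) (Sum.elim b d) =
      if a = b then T (shift (wtAll a) x) c d else 0 :=
  if_congr Iff.rfl rfl rfl

section

variable (T : AuxMat Λ m W) (T' : AuxMat Λ m' W) (x : Λ.Pt)
  (Z : Matrix (Fin m ⊕ Fin m' → Fin n) (Fin m ⊕ Fin m' → Fin n) (Module.End ℂ W))
  (p : Fin m ⊕ Fin m' → Fin n) (a : Fin m → Fin n) (c : Fin m' → Fin n)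

theorem onLeft_mul_apply : (onLeft (m' := m') T x * Z) (Sum.elim a c) p =
    ∑ b, T (shift (wtAll c) x) a b * Z (Sum.elim b c) p := by
  rw [Matrix.mul_apply, sum_sumElim]
  simp only [onLeft_apply]
  refine Finset.sum_congr rfl fun b _ => (Finset.sum_eq_single c ?_ (by simp)).trans ?_
  · intro y _ hy
    rw [if_neg hy.symm]
    exact zero_mul _
  · rw [if_pos rfl]

theorem onRight_mul_apply : (onRight (m := m) T' x * Z) (Sum.elim a c) p =
    ∑ d, T' (shift (wtAll a) x) c d * Z (Sum.elim a d) p := by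
  rw [Matrix.mul_apply, sum_sumElim, Finset.sum_comm]
  simp only [onRight_apply]
  refine Finset.sum_congr rfl fun b _ => (Finset.sum_eq_single a ?_ (by simp)).trans ?_
  · intro y _ hy
    rw [if_neg hy.symm]
    exact zero_mul _
  · rw [if_pos rfl]

theorem mul_onLeft_apply : (Z * onLeft (m' := m') T x) p (Sum.elim a c) =
    ∑ b, Z p (Sum.elim b c) * T (shift (wtAll c) x) b a := by
  rw [Matrix.mul_apply, sum_sumElim]
  simp only [onLeft_apply]
  refine Finset.sum_congr rfl fun b _ => (Finset.sum_eq_single c ?_ (by simp)).trans ?_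
  · intro y _ hy
    rw [if_neg hy]
    exact mul_zero _
  · rw [if_pos rfl]

theorem mul_onRight_apply : (Z * onRight (m := m) T' x) p (Sum.elim a c) =
    ∑ d, Z p (Sum.elim a d) * T' (shift (wtAll a) x) d c := by
  rw [Matrix.mul_apply, sum_sumElim, Finset.sum_comm]
  simp only [onRight_apply]
  refine Finset.sum_congr rfl fun b _ => (Finset.sum_eq_single a ?_ (by simp)).trans ?_
  · intro y _ hy
    rw [if_neg hy]
    exact mul_zero _
  · rw [if_pos rfl]

variable (B : Λ.Pt → Matrix (Fin m ⊕ Fin m' → Fin n) (Fin m ⊕ Fin m' → Fin n) ℂ)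
  (b' : Fin m → Fin n) (d : Fin m' → Fin n)

theorem onLeft_scal_onRight_apply :
    (onLeft T x * scal W (B x) * onRight T' x :
      Matrix (Fin m ⊕ Fin m' → Fin n) (Fin m ⊕ Fin m' → Fin n) (Module.End ℂ W))
      (Sum.elim a c) (Sum.elim b' d) =
      ∑ k : (Fin m → Fin n) × (Fin m' → Fin n), curryMat B x k.1 c b' k.2 •
        (T (shift (wtAll c) x) a k.1 * T' (shift (wtAll b') x) k.2 d) := by
  rw [mul_onRight_apply, Fintype.sum_prod_type, Finset.sum_comm]
  refine Finset.sum_congr rfl fun c' _ => ?_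
  rw [onLeft_mul_apply, Finset.sum_mul]
  refine Finset.sum_congr rfl fun b _ => ?_
  rw [scal, Matrix.map_apply, ← Algebra.commutes, ← Algebra.smul_def, smul_mul_assoc]
  rfl

theorem onRight_scal_onLeft_apply :
    (onRight T' x * scal W (B x) * onLeft T x :
      Matrix (Fin m ⊕ Fin m' → Fin n) (Fin m ⊕ Fin m' → Fin n) (Module.End ℂ W))
      (Sum.elim a c) (Sum.elim b' d) =
      ∑ k : (Fin m' → Fin n) × (Fin m → Fin n), curryMatSwap B x k.1 a d k.2 •
        (T' (shift (wtAll a) x) c k.1 * T (shift (wtAll d) x) k.2 b') := by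
  rw [mul_onLeft_apply, Fintype.sum_prod_type, Finset.sum_comm]
  refine Finset.sum_congr rfl fun c' _ => ?_
  rw [onRight_mul_apply, Finset.sum_mul]
  refine Finset.sum_congr rfl fun b _ => ?_
  rw [scal, Matrix.map_apply, ← Algebra.commutes, ← Algebra.smul_def, smul_mul_assoc]
  rfl

end

theorem pairing_onLeft_onRight
    {B B' : Λ.Pt → Matrix (Fin m ⊕ Fin m' → Fin n) (Fin m ⊕ Fin m' → Fin n) ℂ}
    (hB : ∀ x, PreservesWt (B x)) (h : CrossInv wtAll (curryMat B) (curryMat B'))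
    (T : AuxMat Λ m W) (T' : AuxMat Λ m' W) (K : AuxMat Λ m W') (K' : AuxMat Λ m' W')
    (f : Λ.Pt → W ⊗[ℂ] W') :
    pairing wtAll (fun x => onLeft T x * scal W (B x) * onRight T' x)
      (fun x => onLeft K x * scal W' (B' x) * onRight K' x) f =
      pairing wtAll T K (pairing wtAll T' K' f) := by
  funext x
  rw [pairing_pairing h (v := wtAll) (fun y _ _ _ _ hne => (hB y).sumElim hne)]
  simp only [pairing, sum_sumElim, onLeft_scal_onRight_apply, wtAll_sumElim]

theorem pairing_onRight_onLeft
    {C C' : Λ.Pt → Matrix (Fin m ⊕ Fin m' → Fin n) (Fin m ⊕ Fin m' → Fin n) ℂ}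
    (hC : ∀ x, PreservesWt (C x)) (h : CrossInv wtAll (curryMatSwap C) (curryMatSwap C'))
    (T : AuxMat Λ m W) (T' : AuxMat Λ m' W) (K : AuxMat Λ m W') (K' : AuxMat Λ m' W')
    (f : Λ.Pt → W ⊗[ℂ] W') :
    pairing wtAll (fun x => onRight T' x * scal W (C x) * onLeft T x)
      (fun x => onRight K' x * scal W' (C' x) * onLeft K x) f =
      pairing wtAll T' K' (pairing wtAll T K f) := by
  funext x
  rw [pairing_pairing h (v := wtAll) (fun y _ _ _ _ hne => by
    rw [add_comm, (hC y).sumElim hne, add_comm])]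
  simp only [pairing, sum_sumElim, onRight_scal_onLeft_apply, wtAll_sumElim]
  rw [Finset.sum_comm]
  refine Finset.sum_congr rfl fun c _ => Finset.sum_congr rfl fun a _ => ?_
  rw [Finset.sum_comm]
  refine Finset.sum_congr rfl fun d _ => Finset.sum_congr rfl fun b' _ => ?_
  rw [add_comm (wtAll c), add_comm (wtAll d)]

/-! ### Commutativity of the Hamiltonians -/

/-- The two sides of a pair of exchange relations give the same difference operator. -/
theorem FusedExchange.pairing_eq {A B C D A' B' C' D' : StructMat Λ U} {M : Fin m → U}
    {N : Fin m' → U} {T : AuxMat Λ m W} {T' : AuxMat Λ m' W} {K : AuxMat Λ m W'}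
    {K' : AuxMat Λ m' W'} (hT : FusedExchange A B C D M N T T')
    (hK : FusedExchange A' B' C' D' M N K K') (f : Λ.Pt → W ⊗[ℂ] W') :
    pairing wtAll
        (fun x => scal W (fuseA A M N x) * (onLeft T x * scal W (fuseB B M N x) * onRight T' x))
        (fun x => scal W' (fuseA A' M N x) *
          (onLeft K x * scal W' (fuseB B' M N x) * onRight K' x)) f =
      pairing wtAll
        (fun x => (onRight T' x * scal W (fuseC C M N x) * onLeft T x) * scal W (fuseD D M N x))
        (fun x => (onRight K' x * scal W' (fuseC C' M N x) * onLeft K x) *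
          scal W' (fuseD D' M N x)) f := by
  have h1 := funext hT
  have h2 := funext hK
  simp only [Matrix.mul_assoc] at h1 h2 ⊢
  rw [h1, h2]

theorem commute_hamiltonian {A B C D : StructMat Λ U}
    (hABCD : IsStructureMatrices A B C D)
    {Vq Vq' : Type*} [AddCommGroup Vq] [Module ℂ Vq] [AddCommGroup Vq'] [Module ℂ Vq']
    (M : Fin m → U) (N : Fin m' → U)
    (TM : AuxMat Λ m Vq) (TN : AuxMat Λ m' Vq)
    (KM : AuxMat Λ m Vq') (KN : AuxMat Λ m' Vq')
    (hT : FusedExchange A B C D M N TM TN)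
    (hK : DualFusedExchange A B C D M N KM KN) :
    Commute (hamiltonian TM KM) (hamiltonian TN KN) := by
  have hA := hABCD.zeroWeight_A
  have hB := hABCD.zeroWeight_B
  have hC := hABCD.zeroWeight_C
  have hD := hABCD.zeroWeight_D
  have hAd := transpose_fuseA_mul (hABCD.unitary_A.transpose_mul_dualA hA) M N
  -- `D` stands on the right of the exchange relation, so its removal needs the inverse relation
  -- with the transpose on the dual.
  have hDd : ∀ x, fuseD D M N x * (fuseD (dualD D) M N x)ᵀ = 1 := by
    intro x
    have h := transpose_fuseD_mul (hABCD.unitary_D.transpose_mul_dualD hD) M N x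
    rw [mul_eq_one_comm] at h
    simpa using congrArg Matrix.transpose h
  refine LinearMap.ext fun f => ?_
  rw [Module.End.mul_apply, Module.End.mul_apply]
  simp only [hamiltonian_apply]
  calc _ = _ := (pairing_onLeft_onRight (hB.fuseB M N)
        (crossInv_fuseB hB hABCD.isUnit_crossB M N) TM TN KM KN f).symm
    _ = _ := (pairing_scal_mul (hA.fuseA M N) hAd _ _ f).symm
    _ = _ := hT.pairing_eq hK f
    _ = _ := pairing_mul_scal (hD.fuseD M N) hDd _ _ f
    _ = _ := pairing_onRight_onLeft (hC.fuseC M N)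
        (crossInv_fuseC hC hABCD.isUnit_crossC M N) TM TN KM KN f

end

end FullyDynamical

end

theorem mainTheorem4 {n : ℕ} {γ : ℂ} {Λ : FullyDynamical.DynDomain n γ} {U : Type*}
    {A B C D : FullyDynamical.StructMat Λ U}
    (hABCD : FullyDynamical.IsStructureMatrices A B C D)
    {Vq Vq' : Type*} [AddCommGroup Vq] [Module ℂ Vq] [AddCommGroup Vq'] [Module ℂ Vq']
    {m m' : ℕ} (M : Fin m → U) (N : Fin m' → U)
    (TM : FullyDynamical.AuxMat Λ m Vq) (TN : FullyDynamical.AuxMat Λ m' Vq)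
    (KM : FullyDynamical.AuxMat Λ m Vq') (KN : FullyDynamical.AuxMat Λ m' Vq')
    (hT : FullyDynamical.FusedExchange A B C D M N TM TN)
    (hK : FullyDynamical.DualFusedExchange A B C D M N KM KN) :
    Commute (FullyDynamical.hamiltonian TM KM) (FullyDynamical.hamiltonian TN KN) := by
  exact FullyDynamical.commute_hamiltonian hABCD M N TM TN KM KN hT hK
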